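/- **Conventions.** A (real) commutative superalgebra is a $\mathbb Z_2$-graded unital associative $\mathbb R$-algebra $A=A_0\oplus A_1$ with $ab=(-1)^{|a||b|}ba$ for homogeneous $a,b$; morphisms are parity-preserving unital algebra homomorphisms. A *super Weil algebra* is a finite-dimensional commutative superalgebra of the form $A=\mathbb R\oplus N$ with $N$ a graded nilpotent ideal; each $a\in A$ is written uniquely as $a=\tilde a+\mathring a$ with $\tilde a\in\mathbb R$, $\mathring a\in N$. They form a full subcategory $\mathsf{SWA}$ of the category of commutative superalgebras. For an open set $|U|\subseteq\mathbb R^p$, the superdomain $U\subseteq\mathbb R^{p|q}$ with underlying set $|U|$ has algebra of global sections $\mathcal O(U)=C^\infty(|U|)\otimes\Lambda(\theta_1,\dots,\theta_q)$, with even coordinates $x_1,\dots,x_p$ and odd coordinates $\theta_1,\dots,\theta_q$. Its functor of $A$-points $U_{(-)}\colon\mathsf{SWA}\to\mathsf{Set}$ is $A\mapsto U_A=\operatorname{Hom}(\mathcal O(U),A)$ (superalgebra morphisms), with $\rho\colon A\to B$ acting by $x_A\mapsto\rho\circ x_A$. The base point of $x_A\in U_A$ is the point $\tilde x_A\in|U|$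 with coordinates $\widetilde{x_A(x_1)},\dots,\widetilde{x_A(x_p)}$. Let $\mathcal F_{p|q}(|U|)=\mathrm{Fun}(|U|,\mathbb R)[[X_1,\dots,X_p,\Theta_1,\dots,\Theta_q]]$ be the superalgebra of formal series $F=\sum_{\nu\in\mathbb N^p,\ J\subseteq\{1,\dots,q\}}f_{\nu,J}X^\nu\Theta^J$ in $p$ even and $q$ odd generators whose coefficients $f_{\nu,J}\colon|U|\to\mathbb R$ are arbitrary functions ($\Theta^J$ is the product in increasing order of indices). $F$ is even (odd) if only terms with $|J|$ even (odd) occur. **Proposition.** Let $U$ and $V$ be superdomains in $\mathbb R^{p|q}$ and $\mathbb R^{m|n}$. There is a bijection between the set of tuples $$\boldsymbol F=(F_1,\dots,F_{m+n})\in\big(\mathcal F_{p|q}(|U|)\big)_0^m\times\big(\mathcal F_{p|q}(|U|)\big)_1^n,\qquad F_k=\sum_{\nu,J}f^k_{\nu,J}X^\nu\Theta^J,$$ such that $\big(f^1_{0,\emptyset}(x),\dots,f^m_{0,\emptyset}(x)\big)\in|V|$ for all $x\in|U|$, and the set of natural transformations $\alpha\colon U_{(-)}\to V_{(-)}$ of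 functors $\mathsf{SWA}\to\mathsf{Set}$. Under this bijection, if $\alpha$ corresponds to $\boldsymbol F$, then for every super Weil algebra $A$ and every $x_A\in U_A$, the values of $\alpha_A(x_A)\in V_A$ on the $m$ even and $n$ odd coordinates of $V$ are, for $k=1,\dots,m+n$, $$\sum_{\nu,J}f^k_{\nu,J}(\tilde x_A)\;\mathring{\mathrm x}_1^{\nu_1}\cdots\mathring{\mathrm x}_p^{\nu_p}\;\prod_{j\in J}\vartheta_j,\qquad \mathrm x_i=x_A(x_i),\quad \vartheta_j=x_A(\theta_j)$$ (product over $J$ in increasing order; only finitely many terms are non-zero). -/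

import Mathlib

open CategoryTheory TensorProduct TopologicalSpace
open scoped Manifold ContDiff

noncomputable section

/-! ### Real commutative superalgebras -/

/-- A real (unital, associative) commutative superalgebra: a `ZMod 2`-graded real algebra with
`a * b = (-1) ^ (|a| |b|) b * a` for homogeneous `a`, `b`. -/
structure SuperAlg where
  carrier : Type
  [ring : Ring carrier]
  [algebra : Algebra ℝ carrier]
  /-- `part 0` is the even part and `part 1` is the odd part. -/
  part : ZMod 2 → Submodule ℝ carrier
  [graded : GradedAlgebra part]
  supercomm : ∀ (i j : ZMod 2) (a b : carrier), a ∈ part i → b ∈ part j →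
    a * b = (-1 : ℝ) ^ (i.val * j.val) • (b * a)

namespace SuperAlg

instance : CoeSort SuperAlg Type := ⟨SuperAlg.carrier⟩

attribute [instance] SuperAlg.ring SuperAlg.algebra SuperAlg.graded

/-- Morphisms of superalgebras are the parity preserving unital algebra homomorphisms. -/
instance : Category SuperAlg where
  Hom A B := A.part →ₐᵍ[ℝ] B.part
  id A := GradedAlgHom.id ℝ A.part
  comp f g := GradedAlgHom.comp g f

/-- The algebra homomorphism underlying a morphism of superalgebras. -/
def toAlgHom {A B : SuperAlg} (f : A ⟶ B) : A →ₐ[ℝ] B := GradedAlgHom.toAlgHom f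

end SuperAlg

/-! ### Grassmann extensions of commutative algebras -/

/-- The real Grassmann algebra on `q` generators. -/
abbrev Grassmann (q : ℕ) : Type := ExteriorAlgebra ℝ (Fin q → ℝ)

namespace Grassmann

/-- The parity grading of the Grassmann algebra. -/
abbrev parity (q : ℕ) : ZMod 2 → Submodule ℝ (Grassmann q) :=
  CliffordAlgebra.evenOdd (0 : QuadraticForm ℝ (Fin q → ℝ))

/-- The `j`-th odd generator. -/
def gen {q : ℕ} (j : Fin q) : Grassmann q := ExteriorAlgebra.ι ℝ (Pi.single j 1)

/-- The basis of the Grassmann algebra consisting of the ordered monomials in the generators. -/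
def monomialBasis (q : ℕ) : Module.Basis (Finset (Fin q)) ℝ (Grassmann q) :=
  (Pi.basisFun ℝ (Fin q)).ExteriorAlgebra

theorem gen_mem {q : ℕ} (j : Fin q) : gen j ∈ parity q 1 :=
  CliffordAlgebra.ι_mem_evenOdd_one _ _

theorem ι_mul {q : ℕ} (m : Fin q → ℝ) (b : Grassmann q) :
    CliffordAlgebra.ι (0 : QuadraticForm ℝ (Fin q → ℝ)) m * b =
      CliffordAlgebra.involute b * CliffordAlgebra.ι (0 : QuadraticForm ℝ (Fin q → ℝ)) m := by
  induction b using CliffordAlgebra.induction with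
  | algebraMap r => simpa using (Algebra.commutes r _).symm
  | ι x =>
    have h := ExteriorAlgebra.ι_add_mul_swap (R := ℝ) m x
    rw [CliffordAlgebra.involute_ι, neg_mul]
    exact eq_neg_of_add_eq_zero_left h
  | mul a b ha hb => rw [map_mul, ← mul_assoc, ha, mul_assoc, hb, mul_assoc]
  | add a b ha hb => rw [map_add, mul_add, add_mul, ha, hb]

theorem ι_mul_ι_mul {q : ℕ} (m₁ m₂ : Fin q → ℝ) (b : Grassmann q) :
    CliffordAlgebra.ι (0 : QuadraticForm ℝ (Fin q → ℝ)) m₁ *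
        CliffordAlgebra.ι (0 : QuadraticForm ℝ (Fin q → ℝ)) m₂ * b =
      b * (CliffordAlgebra.ι (0 : QuadraticForm ℝ (Fin q → ℝ)) m₁ *
        CliffordAlgebra.ι (0 : QuadraticForm ℝ (Fin q → ℝ)) m₂) := by
  rw [mul_assoc, ι_mul m₂, ← mul_assoc, ι_mul m₁, CliffordAlgebra.involute_involute, mul_assoc]

theorem even_mul {q : ℕ} {a : Grassmann q} (ha : a ∈ parity q 0) (b : Grassmann q) :
    a * b = b * a := by
  induction a, ha using CliffordAlgebra.even_induction with
  | algebraMap r => exact Algebra.commutes r b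
  | add x y hx hy ihx ihy => rw [add_mul, mul_add, ihx, ihy]
  | ι_mul_ι_mul m₁ m₂ x hx ih =>
    rw [mul_assoc, ih, ← mul_assoc, ι_mul_ι_mul, mul_assoc]

theorem odd_mul {q : ℕ} {a : Grassmann q} (ha : a ∈ parity q 1) (b : Grassmann q) :
    a * b = CliffordAlgebra.involute b * a := by
  induction a, ha using CliffordAlgebra.odd_induction with
  | ι m => exact ι_mul m b
  | add x y hx hy ihx ihy => rw [add_mul, mul_add, ihx, ihy]
  | ι_mul_ι_mul m₁ m₂ x hx ih =>
    rw [mul_assoc, ih, ← mul_assoc, ι_mul_ι_mul, mul_assoc]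

theorem supercomm {q : ℕ} (i j : ZMod 2) (a b : Grassmann q) (ha : a ∈ parity q i)
    (hb : b ∈ parity q j) : a * b = (-1 : ℝ) ^ (i.val * j.val) • (b * a) := by
  fin_cases i
  · simpa [ZMod.val] using even_mul ha b
  · fin_cases j
    · simpa [ZMod.val] using (even_mul hb a).symm
    · have h := odd_mul ha b
      rw [CliffordAlgebra.involute_eq_of_mem_odd hb] at h
      simpa [ZMod.val] using h

/-- The basis vector with index `J` is the product, in increasing order, of the generators
with index in `J`. -/
theorem monomialBasis_apply {q : ℕ} (J : Finset (Fin q)) :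
    monomialBasis q J = (J.sort.map gen).prod := by
  rw [monomialBasis, ExteriorAlgebra.basis_apply]
  change ExteriorAlgebra.ιMulti ℝ J.card
    (Pi.basisFun ℝ (Fin q) ∘ Finset.orderEmbOfFin J rfl) = _
  rw [ExteriorAlgebra.ιMulti_apply, ← Finset.listMap_orderEmbOfFin_finRange J rfl, List.map_map,
    List.ofFn_eq_map]
  congr 1
  refine List.map_congr_left fun i _ => ?_
  simp only [Function.comp_apply, Pi.basisFun_apply]
  rfl

end Grassmann

/-- For a commutative real algebra `C`, the superalgebra `C ⊗ Λ(θ₁, …, θ_q)`, in which the elements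
of `C` are even and the `θ_j` are odd. -/
def grassmannExt (C : Type) [CommRing C] [Algebra ℝ C] (q : ℕ) : SuperAlg where
  carrier := C ⊗[ℝ] Grassmann q
  part i := ((Grassmann.parity q i).baseChange C).restrictScalars ℝ
  supercomm i j a b ha hb := by
    have ha' : a ∈ (Grassmann.parity q i).baseChange C := ha
    have hb' : b ∈ (Grassmann.parity q j).baseChange C := hb
    clear ha hb
    rw [Submodule.baseChange_eq_span] at ha' hb'
    induction ha' using Submodule.span_induction with
    | zero => simp
    | add x y _ _ hx hy => rw [add_mul, mul_add, smul_add, hx, hy]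
    | smul c x _ hx => rw [smul_mul_assoc, mul_smul_comm, hx, smul_comm]
    | mem x hx =>
      obtain ⟨u, hu, rfl⟩ := hx
      induction hb' using Submodule.span_induction with
      | zero => simp
      | add y z _ _ hy hz => rw [add_mul, mul_add, smul_add, hy, hz]
      | smul c y _ hy => rw [smul_mul_assoc, mul_smul_comm, hy, smul_comm]
      | mem y hy =>
        obtain ⟨v, hv, rfl⟩ := hy
        simp only [TensorProduct.mk_apply, Algebra.TensorProduct.tmul_mul_tmul, mul_one]
        rw [Grassmann.supercomm i j u v hu hv, TensorProduct.tmul_smul]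

/-! ### Superdomains and their algebras of functions -/

/-- The algebra of smooth real functions on an open subset of `ℝ^p`. -/
abbrev SmoothFun {p : ℕ} (U : Opens (Fin p → ℝ)) : Type :=
  C^∞⟮𝓘(ℝ, Fin p → ℝ), U; 𝓘(ℝ, ℝ), ℝ⟯

/-- The `i`-th coordinate as a smooth function on `U`. -/
def SmoothFun.coord {p : ℕ} (U : Opens (Fin p → ℝ)) (i : Fin p) : SmoothFun U :=
  ⟨fun x => x.1 i, by
    have h : ContDiff ℝ ∞ fun y : Fin p → ℝ => y i := contDiff_apply ℝ ℝ i
    exact h.contMDiff.comp contMDiff_subtype_val⟩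

/-- The superalgebra `C^∞(U) ⊗ Λ(θ₁, …, θ_q)` of global sections of the superdomain of dimension
`p|q` whose underlying open set is `U ⊆ ℝ^p`. -/
abbrev sections {p : ℕ} (U : Opens (Fin p → ℝ)) (q : ℕ) : SuperAlg :=
  grassmannExt (SmoothFun U) q

/-- The even coordinate `x_i` of a superdomain. -/
def evenCoord {p : ℕ} (U : Opens (Fin p → ℝ)) (q : ℕ) (i : Fin p) : sections U q :=
  (SmoothFun.coord U i ⊗ₜ[ℝ] (1 : Grassmann q) : SmoothFun U ⊗[ℝ] Grassmann q)

/-- The odd coordinate `θ_j` of a superdomain. -/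
def oddCoord {p : ℕ} (U : Opens (Fin p → ℝ)) (q : ℕ) (j : Fin q) : sections U q :=
  ((1 : SmoothFun U) ⊗ₜ[ℝ] Grassmann.gen j : SmoothFun U ⊗[ℝ] Grassmann q)

/-! ### Super Weil algebras -/

/-- A super Weil algebra is a finite dimensional real commutative superalgebra `A = ℝ ⊕ N`, where
`N` is a graded nilpotent ideal. -/
def IsSuperWeil : ObjectProperty SuperAlg := fun A =>
  Module.Finite ℝ A ∧ ∃ N : Ideal A, N.IsHomogeneous A.part ∧ IsNilpotent N ∧
    ∀ a : A, ∃! r : ℝ, a - algebraMap ℝ A r ∈ N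

/-- The category of super Weil algebras, a full subcategory of the category of superalgebras. -/
abbrev SWA := IsSuperWeil.FullSubcategory

namespace SWA

/-- The maximal ideal of a super Weil algebra. -/
def nilIdeal (A : SWA) : Ideal A.obj := A.property.2.choose

theorem nilIdeal_homogeneous (A : SWA) : A.nilIdeal.IsHomogeneous A.obj.part :=
  A.property.2.choose_spec.1

theorem nilIdeal_nilpotent (A : SWA) : IsNilpotent A.nilIdeal :=
  A.property.2.choose_spec.2.1

theorem existsUnique_body (A : SWA) (a : A.obj) : ∃! r : ℝ, a - algebraMap ℝ A.obj r ∈ A.nilIdeal :=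
  A.property.2.choose_spec.2.2 a

/-- The projection `A = ℝ ⊕ N → ℝ`. -/
def body (A : SWA) : A.obj →ₐ[ℝ] ℝ where
  toFun a := (A.existsUnique_body a).choose
  map_one' := ((A.existsUnique_body 1).choose_spec.2 1 (by simp)).symm
  map_zero' := ((A.existsUnique_body 0).choose_spec.2 0 (by simp)).symm
  commutes' r := ((A.existsUnique_body _).choose_spec.2 r (by simp)).symm
  map_add' a b := by
    refine ((A.existsUnique_body (a + b)).choose_spec.2 _ ?_).symm
    have ha := (A.existsUnique_body a).choose_spec.1
    have hb := (A.existsUnique_body b).choose_spec.1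
    dsimp only at ha hb ⊢
    rw [map_add, add_sub_add_comm]
    exact A.nilIdeal.add_mem ha hb
  map_mul' a b := by
    refine ((A.existsUnique_body (a * b)).choose_spec.2 _ ?_).symm
    have ha := (A.existsUnique_body a).choose_spec.1
    have hb := (A.existsUnique_body b).choose_spec.1
    dsimp only at ha hb ⊢
    generalize (A.existsUnique_body a).choose = r at *
    generalize (A.existsUnique_body b).choose = t at *
    have h : a * b - algebraMap ℝ A.obj (r * t) =
        a * (b - algebraMap ℝ A.obj t) + algebraMap ℝ A.obj t * (a - algebraMap ℝ A.obj r) := by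
      rw [mul_sub, mul_sub, Algebra.commutes t a, map_mul,
        (Algebra.commutes t (algebraMap ℝ A.obj r))]
      abel
    rw [h]
    exact A.nilIdeal.add_mem (A.nilIdeal.mul_mem_left _ hb) (A.nilIdeal.mul_mem_left _ ha)

/-- The component in `N` of an element of `A = ℝ ⊕ N`. -/
def nilPart (A : SWA) (a : A.obj) : A.obj := a - algebraMap ℝ A.obj (A.body a)

theorem nilPart_mem (A : SWA) (a : A.obj) : A.nilPart a ∈ A.nilIdeal :=
  (A.existsUnique_body a).choose_spec.1

end SWA

/-! ### Points of superdomains with values in super Weil algebras -/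

/-- The functor `A ↦ U_A = Hom(O(U), A)` of `A`-points of a superdomain of dimension `p|q` with
underlying open set `U ⊆ ℝ^p`; a morphism `ρ : A ⟶ B` acts by composition with `ρ`. -/
def points {p : ℕ} (U : Opens (Fin p → ℝ)) (q : ℕ) : SWA ⥤ Type :=
  IsSuperWeil.ι ⋙ coyoneda.obj (Opposite.op (sections U q))

section BasePoint

variable {p q : ℕ} {U : Opens (Fin p → ℝ)} {A : SWA}

/-- The character of the algebra of smooth functions induced by an `A`-point. -/
def character (x : sections U q ⟶ A.obj) : SmoothFun U →ₐ[ℝ] ℝ :=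
  (A.body.comp (SuperAlg.toAlgHom x)).comp
    (Algebra.TensorProduct.includeLeft : SmoothFun U →ₐ[ℝ] SmoothFun U ⊗[ℝ] Grassmann q)

theorem SmoothFun.exists_zero (χ : SmoothFun U →ₐ[ℝ] ℝ) (f : SmoothFun U) (hf : χ f = 0) :
    ∃ x : U, f x = 0 := by
  by_contra! h
  let g : SmoothFun U := ⟨fun x => (f x)⁻¹, fun x => (f.contMDiff x).inv₀ (h x)⟩
  have hg : f * g = 1 := by
    ext x
    exact mul_inv_cancel₀ (h x)
  have := congrArg χ hg
  rw [map_mul, hf, zero_mul, map_one] at this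
  exact zero_ne_one this

theorem SmoothFun.exists_eval (χ : SmoothFun U →ₐ[ℝ] ℝ) (f : SmoothFun U) :
    ∃ x : U, x.1 = (fun i => χ (SmoothFun.coord U i)) ∧ f x = χ f := by
  let g : SmoothFun U := (f - algebraMap ℝ _ (χ f)) ^ 2 +
    ∑ i, (SmoothFun.coord U i - algebraMap ℝ _ (χ (SmoothFun.coord U i))) ^ 2
  have hg : χ g = 0 := by
    simp [g]
  obtain ⟨x, hx⟩ := SmoothFun.exists_zero χ g hg
  have hx' : (f x - χ f) ^ 2 + ∑ i, (x.1 i - χ (SmoothFun.coord U i)) ^ 2 = 0 := by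
    rw [← hx]
    simp only [g, ContMDiffMap.coe_add, ContMDiffMap.coe_pow, Pi.add_apply, Pi.pow_apply]
    congr 1
    change _ = ContMDiffMap.coeFnRingHom (∑ i, _) x
    rw [map_sum, Finset.sum_apply]
    rfl
  have h0 : 0 ≤ ∑ i, (x.1 i - χ (SmoothFun.coord U i)) ^ 2 :=
    Finset.sum_nonneg fun i _ => sq_nonneg _
  have h1 : ∑ i, (x.1 i - χ (SmoothFun.coord U i)) ^ 2 = 0 := by
    nlinarith [sq_nonneg (f x - χ f)]
  rw [Finset.sum_eq_zero_iff_of_nonneg fun i _ => sq_nonneg _] at h1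
  refine ⟨x, funext fun i => ?_, ?_⟩
  · exact sub_eq_zero.1 (pow_eq_zero_iff two_ne_zero |>.1 (h1 i (Finset.mem_univ i)))
  · exact sub_eq_zero.1 (pow_eq_zero_iff two_ne_zero |>.1 (by nlinarith [sq_nonneg (f x - χ f)]))

/-- The base point of an `A`-point: the point of `U` whose coordinates are the real parts of the
images of the even coordinates. -/
def basePoint (x : sections U q ⟶ A.obj) : U :=
  ⟨fun i => A.body (SuperAlg.toAlgHom x (evenCoord U q i)), by
    obtain ⟨y, hy, -⟩ := SmoothFun.exists_eval (character x) 0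
    exact hy ▸ y.2⟩

/-- The value at a point of the real function underlying a section. -/
def evalAt (q : ℕ) (y : U) : sections U q →ₐ[ℝ] ℝ :=
  (Algebra.TensorProduct.lift
    ((Pi.evalAlgHom ℝ (fun _ : U => ℝ) y).comp ContMDiffMap.coeFnAlgHom)
    ExteriorAlgebra.algebraMapInv (fun _ _ => Commute.all _ _) :
      SmoothFun U ⊗[ℝ] Grassmann q →ₐ[ℝ] ℝ)

/-- The real part of an `A`-point is the evaluation at its base point. -/
theorem body_comp_eq_evalAt (x : sections U q ⟶ A.obj) :
    A.body.comp (SuperAlg.toAlgHom x) = evalAt q (basePoint x) := by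
  refine Algebra.TensorProduct.ext ?_ ?_
  · refine AlgHom.ext fun f => ?_
    obtain ⟨y, hy, hf⟩ := SmoothFun.exists_eval (character x) f
    have hy' : basePoint x = y := Subtype.ext hy.symm
    change character x f = evalAt q (basePoint x) (f ⊗ₜ[ℝ] (1 : Grassmann q) :)
    rw [hy', ← hf]
    refine Eq.trans ?_ (Algebra.TensorProduct.lift_tmul _ _ _ _ _).symm
    rw [map_one, mul_one]
    rfl
  · refine ExteriorAlgebra.hom_ext (LinearMap.ext fun v => ?_)
    have key (χ : SmoothFun U ⊗[ℝ] Grassmann q →ₐ[ℝ] ℝ) :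
        χ ((1 : SmoothFun U) ⊗ₜ[ℝ] ExteriorAlgebra.ι ℝ v) = 0 := by
      have h : χ ((1 : SmoothFun U) ⊗ₜ[ℝ] ExteriorAlgebra.ι ℝ v) *
          χ ((1 : SmoothFun U) ⊗ₜ[ℝ] ExteriorAlgebra.ι ℝ v) = 0 := by
        rw [← map_mul, Algebra.TensorProduct.tmul_mul_tmul, ExteriorAlgebra.ι_sq_zero,
          TensorProduct.tmul_zero, map_zero]
      exact mul_self_eq_zero.1 h
    exact (key (A.body.comp (SuperAlg.toAlgHom x))).trans (key (evalAt q (basePoint x))).symm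

end BasePoint

/-! ### Formal series -/

/-- The superalgebra `F(U, ℝ)[[X₁, …, X_p, Θ₁, …, Θ_q]]` of formal series in `p` even and `q` odd
generators, with coefficients in the algebra `U → ℝ` of arbitrary functions on `U`. As there are
only finitely many monomials in the `Θ_j`, it is `F(U, ℝ)[[X₁, …, X_p]] ⊗ Λ(Θ₁, …, Θ_q)`. -/
abbrev FormalSeries {p : ℕ} (U : Opens (Fin p → ℝ)) (q : ℕ) : SuperAlg :=
  grassmannExt (MvPowerSeries (Fin p) (U → ℝ)) q

namespace FormalSeries

variable {p q : ℕ} {U : Opens (Fin p → ℝ)}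

/-- The coefficient `f_{ν,J}` of `X^ν Θ^J`, where `Θ^J` is the product in increasing order. -/
def coeff (F : FormalSeries U q) (ν : Fin p →₀ ℕ) (J : Finset (Fin q)) : U → ℝ :=
  MvPowerSeries.coeff ν
    (((Grassmann.monomialBasis q).baseChange (MvPowerSeries (Fin p) (U → ℝ))).repr F J)

/-- The term `n^ν t^J` for an `A`-point whose even coordinates have nilpotent parts `n` and whose
odd coordinates are `t`; the products are taken in increasing order. -/
def monomial {A : SWA} (x : sections U q ⟶ A.obj) (ν : Fin p →₀ ℕ) (J : Finset (Fin q)) : A.obj :=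
  ((List.finRange p).map fun i =>
      A.nilPart (SuperAlg.toAlgHom x (evenCoord U q i)) ^ ν i).prod *
    (J.sort.map fun j => SuperAlg.toAlgHom x (oddCoord U q j)).prod

/-- Almost all of the terms `n^ν t^J` vanish. -/
theorem finite_support_monomial {A : SWA} (x : sections U q ⟶ A.obj) :
    {νJ : (Fin p →₀ ℕ) × Finset (Fin q) | monomial x νJ.1 νJ.2 ≠ 0}.Finite := by
  obtain ⟨K, hK⟩ := A.nilIdeal_nilpotent
  have hpow (a : A.obj) (ha : a ∈ A.nilIdeal) : a ^ K = 0 := by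
    have : a ^ K ∈ A.nilIdeal ^ K := Submodule.pow_mem_pow _ ha K
    rw [hK] at this
    exact this
  refine Set.Finite.subset (((Set.Finite.pi' fun _ : Fin p => Set.finite_lt_nat K).preimage
    (f := fun ν : Fin p →₀ ℕ => (ν : Fin p → ℕ)) DFunLike.coe_injective.injOn).prod
      (Set.finite_univ : (Set.univ : Set (Finset (Fin q))).Finite)) ?_
  rintro ⟨ν, J⟩ h
  refine ⟨fun i => ?_, trivial⟩
  by_contra hi
  refine h ?_
  have h0 : A.nilPart (SuperAlg.toAlgHom x (evenCoord U q i)) ^ ν i = 0 :=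
    pow_eq_zero_of_le (not_lt.1 hi) (hpow _ (A.nilPart_mem _))
  have h1 : ((List.finRange p).map fun i =>
      A.nilPart (SuperAlg.toAlgHom x (evenCoord U q i)) ^ ν i).prod = 0 :=
    List.prod_eq_zero (List.mem_map.2 ⟨i, List.mem_finRange i, h0⟩)
  simp only [monomial, h1, zero_mul]

/-- The value `∑ f_{ν,J}(y) n^ν t^J` of a formal series at an `A`-point with base point `y`. This is
a finite sum, by `FormalSeries.finite_support_monomial`. -/
def eval {A : SWA} (F : FormalSeries U q) (x : sections U q ⟶ A.obj) : A.obj :=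
  ∑ᶠ νJ : (Fin p →₀ ℕ) × Finset (Fin q),
    coeff F νJ.1 νJ.2 (basePoint x) • monomial x νJ.1 νJ.2

end FormalSeries

/-- The `(m|n)`-tuples of `m` even and `n` odd formal series on `U` such that the constant terms of
the even ones form a map from `U` to `V`. -/
structure SeriesTuple {p m : ℕ} (U : Opens (Fin p → ℝ)) (q : ℕ) (V : Opens (Fin m → ℝ)) (n : ℕ) where
  even : Fin m → FormalSeries U q
  odd : Fin n → FormalSeries U q
  even_mem : ∀ k, even k ∈ (FormalSeries U q).part 0
  odd_mem : ∀ l, odd l ∈ (FormalSeries U q).part 1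
  const_mem : ∀ y : U, (fun k => FormalSeries.coeff (even k) 0 ∅ y) ∈ V

end

noncomputable section

/-! ### Hadamard's lemma -/

/-! A morphism from `O(U)` to a super Weil algebra kills every function vanishing to high order at
its base point, so it sees only Taylor polynomials there. Hence it is determined by its values on
the coordinates (`sections_hom_ext`), and these can be any elements of the right parity whose bodies
form a point of `U` (`exists_sections_hom`). A tuple of series therefore defines a map on points by
evaluation. The map is natural because morphisms preserve bodies and nilpotent parts.

For the converse, `jetAlg y K q` is the algebra of jets of order at most `K` at `y`, extended by the
odd generators, and `jetPoint y K q` is its tautological point. Every point with base point `y` is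
the image of some `jetPoint y K q` (`exists_jetPoint_comp`). By a Yoneda argument a natural
transformation is fixed by its values at these generic points, which are compatible under
truncation.

Taylor expansion identifies jets with truncated polynomials, so for fixed `y` a compatible family is
the same as a formal series with real coefficients (`exists_eval_jetPoint_eq`). Morphisms preserve
base points, so nothing relates the series at different `y`. This is why the coefficients are
arbitrary functions on `U`. -/

/-- Differentiation under the integral sign replaces `F` by its partial derivative, with values in
`H →L[ℝ] E`. The target space must therefore vary in the induction. -/
theorem contDiff_intervalIntegral_nat {H : Type} [NormedAddCommGroup H] [NormedSpace ℝ H]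
    [FiniteDimensional ℝ H] (n : ℕ) :
    ∀ {E : Type} [NormedAddCommGroup E] [NormedSpace ℝ E] [CompleteSpace E] {F : H → ℝ → E},
      ContDiff ℝ ∞ F.uncurry → ContDiff ℝ n fun x => ∫ t in (0 : ℝ)..1, F x t := by
  induction n with
  | zero =>
    intro E _ _ _ F hF
    have hc := hF.continuous
    exact contDiff_zero.2 (intervalIntegral.continuous_parametric_intervalIntegral_of_continuous'
      hc 0 1)
  | succ n ih =>
    intro E _ _ _ F hF
    let F' : H → ℝ → H →L[ℝ] E := fun x t =>
      (fderiv ℝ F.uncurry (x, t)).comp (ContinuousLinearMap.inl ℝ H ℝ)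
    have hF' : ContDiff ℝ ∞ F'.uncurry :=
      (contDiff_infty_iff_fderiv.1 hF).2.clm_comp contDiff_const
    have hd (x : H) (t : ℝ) : HasFDerivAt (fun x => F x t) (F' x t) x := by
      have h1 : HasFDerivAt F.uncurry (fderiv ℝ F.uncurry (x, t)) (x, t) :=
        ((contDiff_infty_iff_fderiv.1 hF).1 (x, t)).hasFDerivAt
      exact HasFDerivAt.comp (f := fun z : H => (z, t)) x h1 (hasFDerivAt_prodMk_left x t)
    have key (x₀ : H) : HasFDerivAt (fun x => ∫ t in (0 : ℝ)..1, F x t)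
        (∫ t in (0 : ℝ)..1, F' x₀ t) x₀ := by
      -- Dominating constant: the partial derivative is bounded on the compact set formed by the
      -- unit ball around `x₀` and `[0, 1]`.
      obtain ⟨C, hC⟩ := ((isCompact_closedBall x₀ 1).prod
        (isCompact_Icc (a := (0 : ℝ)) (b := 1))).exists_bound_of_continuousOn
          hF'.continuous.continuousOn
      have hFc (x : H) : Continuous (F x) := hF.continuous.comp (by fun_prop : Continuous
        fun t : ℝ => (x, t))
      have hFc' (x : H) : Continuous (F' x) := hF'.continuous.comp (by fun_prop : Continuous
        fun t : ℝ => (x, t))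
      refine intervalIntegral.hasFDerivAt_integral_of_dominated_of_fderiv_le
        (bound := fun _ => C) (Metric.closedBall_mem_nhds x₀ one_pos)
        (.of_forall fun x => (hFc x).aestronglyMeasurable) ((hFc x₀).intervalIntegrable _ _)
        (hFc' x₀).aestronglyMeasurable (.of_forall fun t ht x hx => ?_)
        (intervalIntegrable_const) (.of_forall fun t _ x _ => hd x t)
      rw [Set.uIoc_of_le zero_le_one] at ht
      exact hC (x, t) ⟨hx, ht.1.le, ht.2⟩
    rw [Nat.cast_add, Nat.cast_one, contDiff_succ_iff_fderiv]
    refine ⟨fun x => (key x).differentiableAt, fun h => by simp at h, ?_⟩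
    rw [show fderiv ℝ (fun x => ∫ t in (0 : ℝ)..1, F x t) = fun x => ∫ t in (0 : ℝ)..1, F' x t from
      funext fun x => (key x).fderiv]
    exact ih hF'

theorem contDiff_intervalIntegral {H E : Type} [NormedAddCommGroup H] [NormedSpace ℝ H]
    [FiniteDimensional ℝ H] [NormedAddCommGroup E] [NormedSpace ℝ E] [CompleteSpace E]
    {F : H → ℝ → E} (hF : ContDiff ℝ ∞ F.uncurry) :
    ContDiff ℝ ∞ fun x => ∫ t in (0 : ℝ)..1, F x t :=
  contDiff_infty.2 fun n => contDiff_intervalIntegral_nat n hF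

/-- **Hadamard's lemma**. -/
theorem ContDiff.exists_eq_add_sum {p : ℕ} {f : (Fin p → ℝ) → ℝ} (hf : ContDiff ℝ ∞ f)
    (y : Fin p → ℝ) :
    ∃ g : Fin p → (Fin p → ℝ) → ℝ, (∀ i, ContDiff ℝ ∞ (g i)) ∧
      ∀ x, f x = f y + ∑ i, (x i - y i) * g i x := by
  have hf' := contDiff_infty_iff_fderiv.1 hf
  refine ⟨fun i x => ∫ t in (0 : ℝ)..1, fderiv ℝ f (y + t • (x - y)) (Pi.single i 1),
    fun i => contDiff_intervalIntegral ?_, fun x => ?_⟩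
  · have : ContDiff ℝ ∞ fun z : (Fin p → ℝ) × ℝ => y + z.2 • (z.1 - y) := by fun_prop
    exact (hf'.2.comp this).clm_apply contDiff_const
  · have hd (t : ℝ) : HasDerivAt (fun t : ℝ => f (y + t • (x - y)))
        (fderiv ℝ f (y + t • (x - y)) (x - y)) t := by
      have h : HasDerivAt (fun t : ℝ => y + t • (x - y)) (x - y) t := by
        simpa using ((hasDerivAt_id t).smul_const (x - y)).const_add y
      exact (hf'.1 _).hasFDerivAt.comp_hasDerivAt t h
    have hline : Continuous fun t : ℝ => y + t • (x - y) := by fun_prop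
    have hc (v : Fin p → ℝ) : Continuous fun t : ℝ => fderiv ℝ f (y + t • (x - y)) v :=
      (hf'.2.continuous.comp hline).clm_apply continuous_const
    have h := intervalIntegral.integral_eq_sub_of_hasDerivAt (a := 0) (b := 1)
      (fun t _ => hd t) ((hc _).intervalIntegrable _ _)
    simp only [one_smul, zero_smul, add_zero, add_sub_cancel] at h
    rw [← sub_eq_iff_eq_add', ← h]
    simp_rw [← intervalIntegral.integral_const_mul]
    rw [← intervalIntegral.integral_finsetSum
      fun i _ => ((hc _).const_mul _).intervalIntegrable _ _]
    refine intervalIntegral.integral_congr fun t _ => ?_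
    conv_lhs => rw [show fderiv ℝ f (y + t • (x - y)) (x - y) =
      fderiv ℝ f (y + t • (x - y)) (∑ i, (x i - y i) • Pi.single i 1) by
        congr 1
        simpa using pi_eq_sum_univ' (x - y)]
    simp [map_sum]

/-! ### The ideal of smooth functions vanishing at a point. -/

namespace SmoothFun

variable {p : ℕ} {U : Opens (Fin p → ℝ)}

/-- The restriction to `U` of a smooth function on `ℝ^p`. -/
def restrict (U : Opens (Fin p → ℝ)) {f : (Fin p → ℝ) → ℝ} (hf : ContDiff ℝ ∞ f) : SmoothFun U :=
  ⟨fun x => f x.1, hf.contMDiff.comp contMDiff_subtype_val⟩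

theorem contDiffAt_extend (f : SmoothFun U) (x : U) :
    ContDiffAt ℝ ∞ (Subtype.val.extend f 0) x.1 := by
  rw [← contMDiffAt_iff_contDiffAt, ← contMDiffAt_subtype_iff]
  have h : (fun x : U => Subtype.val.extend f 0 x.1) = f :=
    funext fun x => Subtype.val_injective.extend_apply _ _ x
  rw [h]
  exact f.contMDiff x

/-- A function on `U` which is near every point the restriction of a smooth function. -/
def ofContDiffAt (g : (Fin p → ℝ) → ℝ) (hg : ∀ x : U, ContDiffAt ℝ ∞ g x.1) : SmoothFun U :=
  ⟨fun x => g x.1, fun x => contMDiffAt_subtype_iff.2 (hg x).contMDiffAt⟩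

/-- The germ of a smooth function at a point extends to `ℝ^p`. -/
theorem exists_contDiff_eventuallyEq (f : SmoothFun U) (y : U) :
    ∃ g : (Fin p → ℝ) → ℝ, ContDiff ℝ ∞ g ∧ g =ᶠ[nhds y.1] Subtype.val.extend f 0 := by
  obtain ⟨r, hr, hrU⟩ := Metric.isOpen_iff.1 U.isOpen y.1 y.2
  let φ : ContDiffBump y.1 := ⟨r / 4, r / 2, by positivity, by linarith⟩
  refine ⟨fun x => φ x * Subtype.val.extend f 0 x, contDiff_iff_contDiffAt.2 fun x => ?_, ?_⟩
  · by_cases hx : x ∈ U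
    · exact φ.contDiff.contDiffAt.mul (contDiffAt_extend f ⟨x, hx⟩)
    · have hx' : x ∉ tsupport φ := by
        rw [φ.tsupport_eq]
        exact fun h => hx (hrU (Metric.closedBall_subset_ball (half_lt_self hr) h))
      have h0 : (fun x => φ x * Subtype.val.extend f 0 x) =ᶠ[nhds x] fun _ => 0 := by
        filter_upwards [notMem_tsupport_iff_eventuallyEq.1 hx'] with z hz
        simp [hz]
      exact contDiffAt_const.congr_of_eventuallyEq h0
  · filter_upwards [φ.eventuallyEq_one] with z hz
    simp [hz]

/-- The ideal of functions vanishing at a point. -/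
def vanishing (y : U) : Ideal (SmoothFun U) :=
  RingHom.ker ((Pi.evalAlgHom ℝ (fun _ : U => ℝ) y).comp ContMDiffMap.coeFnAlgHom)

theorem mem_vanishing {y : U} {f : SmoothFun U} : f ∈ vanishing y ↔ f y = 0 := Iff.rfl

/-- The `i`-th coordinate centered at `y`. -/
def centeredCoord (y : U) (i : Fin p) : SmoothFun U :=
  coord U i - algebraMap ℝ _ (y.1 i)

theorem sum_apply {ι : Type*} (s : Finset ι) (f : ι → SmoothFun U) (x : U) :
    (∑ i ∈ s, f i) x = ∑ i ∈ s, f i x := by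
  change ContMDiffMap.coeFnRingHom (∑ i ∈ s, f i) x = _
  rw [map_sum, Finset.sum_apply]
  rfl

/-- The ideal of functions vanishing at a point is generated by the centered coordinates. -/
theorem vanishing_eq_span (y : U) : vanishing y = Ideal.span (Set.range (centeredCoord y)) := by
  refine le_antisymm (fun f hf => ?_) (Ideal.span_le.2 ?_)
  · rw [mem_vanishing] at hf
    obtain ⟨g, hg, hgf⟩ := exists_contDiff_eventuallyEq f y
    obtain ⟨h, hh, hgh⟩ := hg.exists_eq_add_sum y.1
    have hgy : g y.1 = 0 := by
      rw [hgf.eq_of_nhds, Subtype.val_injective.extend_apply, hf]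
    -- Hadamard's lemma applies to the global extension `g`, which agrees with `f` only near `y`.
    -- The difference `f - g` is divided by the squared distance `S` to `y`, and writing `f - g = S
    -- * r` puts it in the span too.
    let S : (Fin p → ℝ) → ℝ := fun x => ∑ i, (x i - y.1 i) ^ 2
    have hS : ContDiff ℝ ∞ S := by fun_prop
    have hS0 {x : Fin p → ℝ} (hx : S x = 0) : x = y.1 := by
      rw [Finset.sum_eq_zero_iff_of_nonneg fun i _ => sq_nonneg _] at hx
      exact funext fun i => sub_eq_zero.1 (pow_eq_zero_iff two_ne_zero |>.1
        (hx i (Finset.mem_univ i)))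
    let r : SmoothFun U := ofContDiffAt (fun x => (Subtype.val.extend f 0 x - g x) / S x) <| by
      intro x
      by_cases hx : x = y
      -- Near `y` the numerator vanishes identically, and at `y` itself division by zero gives `0`,
      -- so the quotient is locally constant.
      · have h0 : (fun x => (Subtype.val.extend f 0 x - g x) / S x) =ᶠ[nhds x.1] fun _ => 0 := by
          rw [hx]
          filter_upwards [hgf] with z hz
          simp [hz]
        exact contDiffAt_const.congr_of_eventuallyEq h0
      · exact ((contDiffAt_extend f x).sub hg.contDiffAt).div hS.contDiffAt
          fun h => hx (Subtype.ext (hS0 h))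
    have hfr : f = ∑ i, (centeredCoord y i * r + restrict U (hh i)) * centeredCoord y i := by
      ext x
      rw [sum_apply]
      change f x = ∑ i, ((x.1 i - y.1 i) * r x + h i x.1) * (x.1 i - y.1 i)
      have h1 : f x - g x.1 = S x.1 * r x := by
        change _ = S x.1 * ((Subtype.val.extend f 0 x.1 - g x.1) / S x.1)
        rw [Subtype.val_injective.extend_apply]
        by_cases hx : S x.1 = 0
        · have := hgf.eq_of_nhds
          rw [← hS0 hx, Subtype.val_injective.extend_apply] at this
          rw [hx, this, sub_self, zero_mul]
        · rw [mul_div_cancel₀ _ hx]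
      rw [← sub_add_cancel (f x) (g x.1), h1, hgh, hgy, zero_add, Finset.sum_mul,
        ← Finset.sum_add_distrib]
      exact Finset.sum_congr rfl fun i _ => by ring
    rw [hfr]
    exact Ideal.sum_mem _ fun i _ => Ideal.mul_mem_left _ _ (Ideal.subset_span ⟨i, rfl⟩)
  · rintro _ ⟨i, rfl⟩
    exact mem_vanishing.2 (sub_self _)

end SmoothFun

/-! ### Jets of smooth functions -/

/-- The bound forces `Q` to vanish at `0`, so one factor `X` splits off. On the punctured
neighbourhood a factor `t` can then be cancelled from the bound. -/
theorem Polynomial.X_pow_dvd_of_isBigO (K : ℕ) : ∀ {Q : Polynomial ℝ},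
    ((fun t => Q.eval t) =O[nhdsWithin 0 {0}ᶜ] fun t : ℝ => t ^ K) → Polynomial.X ^ K ∣ Q := by
  induction K with
  | zero => simp
  | succ K ih =>
    intro Q hQ
    have h0 : Q.eval 0 = 0 := by
      have h1 : Filter.Tendsto (fun t : ℝ => t ^ (K + 1)) (nhdsWithin 0 {0}ᶜ) (nhds 0) := by
        have : Continuous fun t : ℝ => t ^ (K + 1) := by fun_prop
        refine (this.tendsto' 0 0 ?_).mono_left nhdsWithin_le_nhds
        simp
      exact tendsto_nhds_unique (Q.continuous.continuousWithinAt (s := {0}ᶜ) (x := 0))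
        (hQ.trans_tendsto h1)
    obtain ⟨R, rfl⟩ := Polynomial.X_dvd_iff.2 ((Polynomial.coeff_zero_eq_eval_zero Q).trans h0)
    rw [pow_succ']
    refine mul_dvd_mul_left _ (ih ?_)
    obtain ⟨c, hc⟩ := hQ.bound
    refine Asymptotics.IsBigO.of_bound c ?_
    filter_upwards [hc, self_mem_nhdsWithin] with t ht ht0
    have ht' : 0 < ‖t‖ := norm_pos_iff.2 ht0
    simp only [Polynomial.eval_mul, Polynomial.eval_X, pow_succ', norm_mul] at ht
    exact le_of_mul_le_mul_left (by linarith) ht'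

namespace MvPolynomial

/-- The restriction of a polynomial to the line through `0` with direction `v`. -/
def restrictLine {p : ℕ} (v : Fin p → ℝ) : MvPolynomial (Fin p) ℝ →ₐ[ℝ] Polynomial ℝ :=
  aeval fun i => Polynomial.C (v i) * Polynomial.X

theorem eval_restrictLine {p : ℕ} (v : Fin p → ℝ) (P : MvPolynomial (Fin p) ℝ) (t : ℝ) :
    (restrictLine v P).eval t = eval (t • v) P := by
  induction P using MvPolynomial.induction_on with
  | C a => simp [restrictLine]
  | add P Q hP hQ => rw [map_add, map_add, Polynomial.eval_add, hP, hQ]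
  | mul_X P i hP =>
    rw [map_mul, map_mul, Polynomial.eval_mul, hP]
    simp [restrictLine, mul_comm t]

theorem coeff_restrictLine {p : ℕ} (v : Fin p → ℝ) (P : MvPolynomial (Fin p) ℝ) (j : ℕ) :
    (restrictLine v P).coeff j = eval v (homogeneousComponent j P) := by
  induction P using MvPolynomial.induction_on' with
  | add P Q hP hQ => rw [map_add, map_add, map_add, Polynomial.coeff_add, hP, hQ]
  | monomial ν a =>
    have h : restrictLine v (monomial ν a) =
        Polynomial.C (eval v (monomial ν a)) * Polynomial.X ^ ν.degree := by
      simp only [restrictLine, aeval_monomial, eval_monomial, Finsupp.prod, mul_pow,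
        Finset.prod_mul_distrib, Finset.prod_pow_eq_pow_sum, map_mul, map_prod, map_pow,
        Polynomial.algebraMap_eq, mul_assoc]
      rfl
    rw [h, Polynomial.coeff_C_mul, Polynomial.coeff_X_pow]
    split_ifs with hj
    · rw [hj, homogeneousComponent_of_mem (isHomogeneous_monomial a rfl), if_pos rfl, mul_one]
    · rw [homogeneousComponent_of_mem (isHomogeneous_monomial a rfl), if_neg hj, map_zero,
        mul_zero]

/-- Along the line with direction `v`, the coefficient of `t ^ j` is the value at `v` of the degree
`j` component. For `j < K` it vanishes for all `v`, so the component is the zero polynomial. -/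
theorem mem_pow_idealOfVars_of_isBigO {p K : ℕ} {P : MvPolynomial (Fin p) ℝ}
    (h : ∀ v : Fin p → ℝ,
      (fun t : ℝ => eval (t • v) P) =O[nhdsWithin 0 {0}ᶜ] fun t : ℝ => t ^ K) :
    P ∈ idealOfVars (Fin p) ℝ ^ K := by
  refine (mem_pow_idealOfVars_iff' _ _).2 fun ν hν => ?_
  have h0 : homogeneousComponent ν.degree P = 0 := by
    refine MvPolynomial.funext fun v => ?_
    rw [map_zero, ← coeff_restrictLine]
    refine Polynomial.X_pow_dvd_iff.1 (Polynomial.X_pow_dvd_of_isBigO K ?_) _ hν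
    simpa only [eval_restrictLine] using h v
  simpa [coeff_homogeneousComponent] using congrArg (coeff ν) h0

theorem aeval_mem_pow {σ B : Type*} [CommRing B] [Algebra ℝ B] {I : Ideal B} {n : σ → B}
    (hn : ∀ i, n i ∈ I) {K : ℕ} {P : MvPolynomial σ ℝ} (hP : P ∈ idealOfVars σ ℝ ^ K) :
    aeval n P ∈ I ^ K := by
  have h : (idealOfVars σ ℝ).map (aeval n : MvPolynomial σ ℝ →ₐ[ℝ] B) ≤ I := by
    rw [idealOfVars, Ideal.map_span, Ideal.span_le]
    rintro _ ⟨_, ⟨i, rfl⟩, rfl⟩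
    simpa using hn i
  have := Ideal.mem_map_of_mem (aeval n : MvPolynomial σ ℝ →ₐ[ℝ] B) hP
  rw [Ideal.map_pow] at this
  exact Ideal.pow_right_mono h K this

end MvPolynomial

namespace SmoothFun

variable {p : ℕ} {U : Opens (Fin p → ℝ)}

/-- The smooth function given by a polynomial in the coordinates centered at `y`. -/
def ofPolynomial (y : U) : MvPolynomial (Fin p) ℝ →ₐ[ℝ] SmoothFun U :=
  MvPolynomial.aeval (centeredCoord y)

theorem ofPolynomial_apply (y x : U) (P : MvPolynomial (Fin p) ℝ) :
    ofPolynomial y P x = MvPolynomial.eval (x.1 - y.1) P := by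
  have h : ((Pi.evalAlgHom ℝ (fun _ : U => ℝ) x).comp ContMDiffMap.coeFnAlgHom).comp
      (ofPolynomial y) = MvPolynomial.aeval (x.1 - y.1) := by
    refine MvPolynomial.algHom_ext fun i => ?_
    simp only [ofPolynomial, AlgHom.comp_apply, MvPolynomial.aeval_X]
    rfl
  exact (congrArg (fun φ => φ P) h).trans
    (congrFun (MvPolynomial.aeval_eq_eval (x.1 - y.1)) P)

/-- Existence of Taylor polynomials. -/
theorem exists_sub_ofPolynomial_mem (y : U) (K : ℕ) : ∀ f : SmoothFun U,
    ∃ P, f - ofPolynomial y P ∈ vanishing y ^ K := by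
  induction K with
  | zero => exact fun f => ⟨0, by simp⟩
  | succ K ih =>
    intro f
    -- Write `f = f y + ∑ g i * (x i - y i)` and replace each `g i` by a Taylor polynomial of one
    -- order less.
    have hf : f - algebraMap ℝ _ (f y) ∈ vanishing y := mem_vanishing.2 (sub_self _)
    rw [vanishing_eq_span, Ideal.mem_span_range_iff_exists_fun] at hf
    obtain ⟨g, hg⟩ := hf
    choose P hP using fun i => ih (g i)
    refine ⟨MvPolynomial.C (f y) + ∑ i, P i * MvPolynomial.X i, ?_⟩
    have h : f - ofPolynomial y (MvPolynomial.C (f y) + ∑ i, P i * MvPolynomial.X i) =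
        ∑ i, (g i - ofPolynomial y (P i)) * centeredCoord y i := by
      simp_rw [sub_mul]
      rw [Finset.sum_sub_distrib, hg, map_add, map_sum, ← sub_sub]
      congr 1
      · congr 1
        exact MvPolynomial.aeval_C _ _
      · refine Finset.sum_congr rfl fun i _ => ?_
        rw [map_mul]
        congr 1
        exact MvPolynomial.aeval_X _ _
    rw [h, pow_succ]
    exact Ideal.sum_mem _ fun i _ => Ideal.mul_mem_mul (hP i) (mem_vanishing.2 (sub_self _))

/-- A differentiable function vanishing at `y` is `O(t)` along a line through `y`, and products
multiply the orders. Extension by zero only makes the expression meaningful for large `t`; near `0`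
the line stays in `U`. -/
theorem isBigO_of_mem_vanishing_pow {y : U} (v : Fin p → ℝ) (K : ℕ) : ∀ {f : SmoothFun U},
    f ∈ vanishing y ^ K →
      (fun t : ℝ => Subtype.val.extend f 0 (y.1 + t • v)) =O[nhds 0] fun t : ℝ => t ^ K := by
  have hd (f : SmoothFun U) :
      DifferentiableAt ℝ (fun t : ℝ => Subtype.val.extend f 0 (y.1 + t • v)) 0 := by
    have h1 : DifferentiableAt ℝ (Subtype.val.extend f 0) (y.1 + (0 : ℝ) • v) := by
      rw [zero_smul, add_zero]
      exact (contDiffAt_extend f y).differentiableAt (by simp)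
    exact h1.comp (f := fun t : ℝ => y.1 + t • v) 0 (by fun_prop)
  have hev : ∀ᶠ t : ℝ in nhds 0, y.1 + t • v ∈ U := by
    have hc : ContinuousAt (fun t : ℝ => y.1 + t • v) 0 := by fun_prop
    refine hc.eventually_mem (U.isOpen.mem_nhds ?_)
    simp
  induction K with
  | zero =>
    intro f _
    simpa using (hd f).continuousAt.isBigO_one ℝ
  | succ K ih =>
    intro f hf
    rw [pow_succ] at hf
    induction hf using Submodule.mul_induction_on' with
    | mem_mul_mem f hf g hg =>
      have h2 := (hd g).isBigO_sub
      simp only [zero_smul, add_zero, Subtype.val_injective.extend_apply, sub_zero,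
        mem_vanishing.1 hg] at h2
      refine ((ih hf).mul h2).congr' ?_ (.of_forall fun t => (pow_succ t K).symm)
      filter_upwards [hev] with t ht
      lift y.1 + t • v to U using ht with z
      simp only [Subtype.val_injective.extend_apply]
      rfl
    | add f _ g _ hf hg =>
      refine (hf.add hg).congr' ?_ .rfl
      filter_upwards [hev] with t ht
      lift y.1 + t • v to U using ht with z
      simp only [Subtype.val_injective.extend_apply]
      rfl

/-- Uniqueness of Taylor polynomials. With their existence, it identifies the jet algebra with
polynomials modulo the `K`-th power of the ideal of the variables. -/
theorem ofPolynomial_mem_vanishing_pow_iff {y : U} {K : ℕ} {P : MvPolynomial (Fin p) ℝ} :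
    ofPolynomial y P ∈ vanishing y ^ K ↔ P ∈ MvPolynomial.idealOfVars (Fin p) ℝ ^ K := by
  refine ⟨fun h => MvPolynomial.mem_pow_idealOfVars_of_isBigO fun v => ?_,
    MvPolynomial.aeval_mem_pow fun i => mem_vanishing.2 (sub_self _)⟩
  refine ((isBigO_of_mem_vanishing_pow v K h).mono nhdsWithin_le_nhds).congr' ?_ .rfl
  have hc : ContinuousAt (fun t : ℝ => y.1 + t • v) 0 := by fun_prop
  filter_upwards [mem_nhdsWithin_of_mem_nhds
    (hc.preimage_mem_nhds (U.isOpen.mem_nhds (by simp)))] with t ht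
  have h1 := Subtype.val_injective.extend_apply (ofPolynomial y P) 0 (⟨_, ht⟩ : U)
  rw [ofPolynomial_apply] at h1
  simpa using h1

end SmoothFun

/-- The Weil algebra of jets of order `< K` at `y`. -/
abbrev Jet {p : ℕ} {U : Opens (Fin p → ℝ)} (y : U) (K : ℕ) : Type :=
  SmoothFun U ⧸ SmoothFun.vanishing y ^ K

/-! ### Jet algebras as truncated polynomial algebras. -/

namespace Jet

variable {p : ℕ} {U : Opens (Fin p → ℝ)} {y : U} {K : ℕ}

/-- The jet of a polynomial in the centered coordinates. -/
def ofPolynomial (y : U) (K : ℕ) : MvPolynomial (Fin p) ℝ →ₐ[ℝ] Jet y K :=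
  (Ideal.Quotient.mkₐ ℝ (SmoothFun.vanishing y ^ K)).comp (SmoothFun.ofPolynomial y)

theorem ofPolynomial_surjective : Function.Surjective (ofPolynomial y K) := by
  intro c
  obtain ⟨f, rfl⟩ := Ideal.Quotient.mk_surjective c
  obtain ⟨P, hP⟩ := SmoothFun.exists_sub_ofPolynomial_mem y K f
  exact ⟨P, ((Ideal.Quotient.mk_eq_mk_iff_sub_mem _ _).2 hP).symm⟩

theorem ofPolynomial_eq_zero_iff {P : MvPolynomial (Fin p) ℝ} :
    ofPolynomial y K P = 0 ↔ P ∈ MvPolynomial.idealOfVars (Fin p) ℝ ^ K :=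
  Ideal.Quotient.eq_zero_iff_mem.trans SmoothFun.ofPolynomial_mem_vanishing_pow_iff

theorem ofPolynomial_eq_iff {P Q : MvPolynomial (Fin p) ℝ} :
    ofPolynomial y K P = ofPolynomial y K Q ↔
      ∀ ν : Fin p →₀ ℕ, ν.degree < K → P.coeff ν = Q.coeff ν := by
  rw [← sub_eq_zero, ← map_sub, ofPolynomial_eq_zero_iff, MvPolynomial.mem_pow_idealOfVars_iff']
  simp only [MvPolynomial.coeff_sub, sub_eq_zero]

/-- Universal property: a jet algebra is a quotient of a polynomial ring, so a map out of it is a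
choice of images of the variables satisfying the truncation relations. -/
theorem exists_lift {B : Type} [CommRing B] [Algebra ℝ B] (n : Fin p → B)
    (hn : ∀ P ∈ MvPolynomial.idealOfVars (Fin p) ℝ ^ K, MvPolynomial.aeval n P = 0) :
    ∃ g : Jet y K →ₐ[ℝ] B, ∀ P, g (ofPolynomial y K P) = MvPolynomial.aeval n P := by
  let φ : (MvPolynomial (Fin p) ℝ ⧸ RingHom.ker (ofPolynomial y K)) →ₐ[ℝ] B :=
    Ideal.Quotient.liftₐ _ (MvPolynomial.aeval n) fun P hP => hn P (ofPolynomial_eq_zero_iff.1 hP)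
  let e := Ideal.quotientKerAlgEquivOfSurjective (ofPolynomial_surjective (y := y) (K := K))
  refine ⟨φ.comp e.symm, fun P => ?_⟩
  have h : e.symm (ofPolynomial y K P) = Ideal.Quotient.mk _ P :=
    (AlgEquiv.symm_apply_eq e).2 rfl
  rw [AlgHom.comp_apply]
  change φ (e.symm (ofPolynomial y K P)) = _
  rw [h]
  rfl

instance : Module.Finite ℝ (Jet y K) := by
  have hfin : {ν : Fin p →₀ ℕ | ν.degree < K}.Finite := Finsupp.finite_of_degree_lt K
  refine ⟨Submodule.fg_def.2 ⟨_, hfin.image fun ν => ofPolynomial y K (MvPolynomial.monomial ν 1),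
    eq_top_iff.2 fun c _ => ?_⟩⟩
  obtain ⟨P, rfl⟩ := ofPolynomial_surjective c
  rw [P.as_sum, map_sum]
  refine Submodule.sum_mem _ fun ν _ => ?_
  by_cases hν : ν.degree < K
  · rw [← mul_one (P.coeff ν), ← smul_eq_mul, ← MvPolynomial.smul_monomial, map_smul]
    exact Submodule.smul_mem _ _ (Submodule.subset_span ⟨ν, hν, rfl⟩)
  · have h0 : ofPolynomial y K (MvPolynomial.monomial ν (P.coeff ν)) = 0 := by
      rw [← map_zero (ofPolynomial y K), ofPolynomial_eq_iff]
      intro μ hμ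
      rw [MvPolynomial.coeff_monomial, if_neg (by rintro rfl; exact hν hμ),
        MvPolynomial.coeff_zero]
    rw [h0]
    exact Submodule.zero_mem _

end Jet

/-! ### Morphisms of superalgebras -/

namespace SuperAlg

variable {A B C : SuperAlg}

/-- A parity preserving algebra homomorphism as a morphism of superalgebras. -/
def ofAlgHom (f : A →ₐ[ℝ] B) (h : ∀ i, ∀ a ∈ A.part i, f a ∈ B.part i) : A ⟶ B :=
  GradedAlgHom.mk f fun hx => h _ _ hx

theorem toAlgHom_comp (f : A ⟶ B) (g : B ⟶ C) :
    toAlgHom (f ≫ g) = (toAlgHom g).comp (toAlgHom f) := rfl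

theorem toAlgHom_injective : Function.Injective (toAlgHom : (A ⟶ B) → A →ₐ[ℝ] B) :=
  GradedAlgHom.coe_toAlgHom_injective

theorem toAlgHom_mem (f : A ⟶ B) {i : ZMod 2} {a : A} (ha : a ∈ A.part i) :
    toAlgHom f a ∈ B.part i :=
  GradedRingHom.map_mem (GradedAlgHom.toGradedRingHom f) ha

theorem even_commute {a : A} (ha : a ∈ A.part 0) (b : A) : Commute a b := by
  induction b using DirectSum.Decomposition.inductionOn A.part with
  | zero => exact Commute.zero_right a
  | @homogeneous i b =>
    have h := A.supercomm 0 i a b ha b.2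
    simp only [ZMod.val_zero, zero_mul, pow_zero, one_smul] at h
    exact h
  | add b c hb hc => exact hb.add_right hc

theorem odd_mul_self {a : A} (ha : a ∈ A.part 1) : a * a = 0 := by
  have h := A.supercomm 1 1 a a ha ha
  rw [show (1 : ZMod 2).val * (1 : ZMod 2).val = 1 from rfl, pow_one, neg_one_smul] at h
  have h2 : (2 : ℝ) • (a * a) = 0 := by rw [two_smul, ← eq_neg_iff_add_eq_zero]; exact h
  exact (smul_eq_zero.1 h2).resolve_left two_ne_zero

/-- The even part, as a subalgebra. -/
def evenPart (A : SuperAlg) : Subalgebra ℝ A where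
  carrier := A.part 0
  mul_mem' ha hb := by simpa using SetLike.mul_mem_graded ha hb
  add_mem' ha hb := add_mem ha hb
  algebraMap_mem' r := SetLike.algebraMap_mem_graded A.part r

/-- Polynomial evaluation and lifts of jets need a commutative target; values of even coordinates
are handled inside this ring. -/
instance : CommRing A.evenPart :=
  { (inferInstance : Ring A.evenPart) with
    mul_comm := fun a b => Subtype.ext (even_commute a.2 b.1) }

end SuperAlg

/-! ### Morphisms out of Grassmann extensions. -/

namespace grassmannExt

variable {C : Type} [CommRing C] [Algebra ℝ C] {q : ℕ} {A : SuperAlg}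

/-- The inclusion of the coefficients. -/
def inl (C : Type) [CommRing C] [Algebra ℝ C] (q : ℕ) : C →ₐ[ℝ] grassmannExt C q :=
  (Algebra.TensorProduct.includeLeft : C →ₐ[ℝ] C ⊗[ℝ] Grassmann q)

/-- The inclusion of the Grassmann algebra. -/
def inr (C : Type) [CommRing C] [Algebra ℝ C] (q : ℕ) : Grassmann q →ₐ[ℝ] grassmannExt C q :=
  (Algebra.TensorProduct.includeRight : Grassmann q →ₐ[ℝ] C ⊗[ℝ] Grassmann q)

theorem inl_mem (c : C) : inl C q c ∈ (grassmannExt C q).part 0 := by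
  change (c ⊗ₜ[ℝ] (1 : Grassmann q)) ∈ (Grassmann.parity q 0).baseChange C
  exact Submodule.tmul_mem_baseChange_of_mem c (SetLike.GradedOne.one_mem)

theorem inr_mem {i : ZMod 2} {b : Grassmann q} (hb : b ∈ Grassmann.parity q i) :
    inr C q b ∈ (grassmannExt C q).part i := by
  change ((1 : C) ⊗ₜ[ℝ] b) ∈ (Grassmann.parity q i).baseChange C
  exact Submodule.tmul_mem_baseChange_of_mem 1 hb

theorem tmul_eq (c : C) (b : Grassmann q) :
    (c ⊗ₜ[ℝ] b : C ⊗[ℝ] Grassmann q) = (inl C q c * inr C q b : grassmannExt C q) := by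
  change c ⊗ₜ[ℝ] b = (c ⊗ₜ[ℝ] (1 : Grassmann q)) * ((1 : C) ⊗ₜ[ℝ] b)
  rw [Algebra.TensorProduct.tmul_mul_tmul, mul_one, one_mul]

theorem exists_eq_sum {i : ZMod 2} {z : C ⊗[ℝ] Grassmann q}
    (hz : z ∈ (Grassmann.parity q i).baseChange C) :
    ∃ (n : ℕ) (f : Fin n → C) (b : Fin n → Grassmann q), (∀ k, b k ∈ Grassmann.parity q i) ∧
      z = (∑ k, inl C q (f k) * inr C q (b k) : grassmannExt C q) := by
  rw [Submodule.baseChange_eq_span] at hz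
  obtain ⟨n, f, g, rfl⟩ := Submodule.mem_span_set'.1 hz
  choose b hb hbg using fun k => (g k).2
  refine ⟨n, f, b, hb, Finset.sum_congr rfl fun k _ => ?_⟩
  rw [← tmul_eq, ← hbg]
  simp [TensorProduct.smul_tmul']

theorem part_induction {i : ZMod 2} {motive : grassmannExt C q → Prop}
    (zero : motive 0)
    (mul : ∀ c, ∀ b ∈ Grassmann.parity q i, motive (inl C q c * inr C q b))
    (add : ∀ x ∈ (grassmannExt C q).part i, ∀ y ∈ (grassmannExt C q).part i,
      motive x → motive y → motive (x + y))
    (z : grassmannExt C q) (hz : z ∈ (grassmannExt C q).part i) : motive z := by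
  obtain ⟨n, f, b, hb, rfl⟩ := exists_eq_sum hz
  have hk (k : Fin n) : inl C q (f k) * inr C q (b k) ∈ (grassmannExt C q).part i := by
    simpa using SetLike.mul_mem_graded (inl_mem (q := q) (f k)) (inr_mem (C := C) (hb k))
  have h (s : Finset (Fin n)) :
      ∑ k ∈ s, inl C q (f k) * inr C q (b k) ∈ (grassmannExt C q).part i ∧
        motive (∑ k ∈ s, inl C q (f k) * inr C q (b k)) := by
    induction s using Finset.cons_induction with
    | empty => exact ⟨by simp, by simpa using zero⟩
    | cons k s hks ih =>
      rw [Finset.sum_cons]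
      exact ⟨add_mem (hk k) ih.1, add _ (hk k) _ ih.1 (mul _ _ (hb k)) ih.2⟩
  exact (h Finset.univ).2

theorem algHom_ext {B : Type} [Ring B] [Algebra ℝ B] {f g : grassmannExt C q →ₐ[ℝ] B}
    (hl : ∀ c, f (inl C q c) = g (inl C q c))
    (hr : ∀ j, f (inr C q (Grassmann.gen j)) = g (inr C q (Grassmann.gen j))) : f = g := by
  refine Algebra.TensorProduct.ext (AlgHom.ext hl) (ExteriorAlgebra.hom_ext ?_)
  refine LinearMap.pi_ext' fun j => LinearMap.ext_ring ?_
  exact hr j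

theorem hom_ext {f g : grassmannExt C q ⟶ A}
    (hl : ∀ c, SuperAlg.toAlgHom f (inl C q c) = SuperAlg.toAlgHom g (inl C q c))
    (hr : ∀ j, SuperAlg.toAlgHom f (inr C q (Grassmann.gen j)) =
      SuperAlg.toAlgHom g (inr C q (Grassmann.gen j))) : f = g :=
  SuperAlg.toAlgHom_injective (algHom_ext hl hr)

/-- Odd elements, and their linear combinations, square to zero, which gives the map on the
Grassmann algebra. Even elements are central, so it combines with `f` on the tensor product. -/
theorem exists_hom (f : C →ₐ[ℝ] A) (hf : ∀ c, f c ∈ A.part 0) (b : Fin q → A)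
    (hb : ∀ j, b j ∈ A.part 1) :
    ∃ x : grassmannExt C q ⟶ A, (∀ c, SuperAlg.toAlgHom x (inl C q c) = f c) ∧
      ∀ j, SuperAlg.toAlgHom x (inr C q (Grassmann.gen j)) = b j := by
  let l : (Fin q → ℝ) →ₗ[ℝ] A := Fintype.linearCombination ℝ b
  have hl (v : Fin q → ℝ) : l v ∈ A.part 1 := by
    rw [Fintype.linearCombination_apply]
    exact Submodule.sum_mem _ fun j _ => Submodule.smul_mem _ _ (hb j)
  let g : Grassmann q →ₐ[ℝ] A :=
    ExteriorAlgebra.lift ℝ ⟨l, fun v => SuperAlg.odd_mul_self (hl v)⟩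
  have hgι (v : Fin q → ℝ) :
      g (CliffordAlgebra.ι (0 : QuadraticForm ℝ (Fin q → ℝ)) v) = l v :=
    ExteriorAlgebra.lift_ι_apply ℝ l (fun v => SuperAlg.odd_mul_self (hl v)) v
  have hιι {i : ZMod 2} {a : A} (v w : Fin q → ℝ) (ha : a ∈ A.part i) :
      l v * l w * a ∈ A.part i := by
    have h := SetLike.mul_mem_graded (SetLike.mul_mem_graded (hl v) (hl w)) ha
    rwa [show (1 + 1 + i : ZMod 2) = i by
      rw [show (1 + 1 : ZMod 2) = 0 from rfl, zero_add]] at h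
  have hg0 {u : Grassmann q} (hu : u ∈ Grassmann.parity q 0) : g u ∈ A.part 0 := by
    induction u, hu using CliffordAlgebra.even_induction with
    | algebraMap r =>
      rw [AlgHom.commutes]
      exact SetLike.algebraMap_mem_graded _ _
    | add x y hx hy ihx ihy => rw [map_add]; exact add_mem ihx ihy
    | ι_mul_ι_mul v w x hx ih => rw [map_mul, map_mul, hgι, hgι]; exact hιι v w ih
  have hg1 {u : Grassmann q} (hu : u ∈ Grassmann.parity q 1) : g u ∈ A.part 1 := by
    induction u, hu using CliffordAlgebra.odd_induction with
    | ι v => rw [hgι]; exact hl v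
    | add x y hx hy ihx ihy => rw [map_add]; exact add_mem ihx ihy
    | ι_mul_ι_mul v w x hx ih => rw [map_mul, map_mul, hgι, hgι]; exact hιι v w ih
  have hg {i : ZMod 2} {u : Grassmann q} (hu : u ∈ Grassmann.parity q i) : g u ∈ A.part i := by
    fin_cases i
    exacts [hg0 hu, hg1 hu]
  let φ : grassmannExt C q →ₐ[ℝ] A :=
    Algebra.TensorProduct.lift f g fun c u => SuperAlg.even_commute (hf c) (g u)
  have hφl (c : C) : φ (inl C q c) = f c :=
    (Algebra.TensorProduct.lift_tmul f g _ c 1).trans (by rw [map_one, mul_one])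
  have hφr (u : Grassmann q) : φ (inr C q u) = g u :=
    (Algebra.TensorProduct.lift_tmul f g _ 1 u).trans (by rw [map_one, one_mul])
  refine ⟨SuperAlg.ofAlgHom φ fun i a ha => ?_, hφl, fun j => (hφr _).trans ?_⟩
  · refine part_induction (motive := fun z => φ z ∈ A.part i) ?_ (fun c u hu => ?_)
      (fun x _ y _ hx hy => ?_) a ha
    · rw [map_zero]
      exact zero_mem _
    · rw [map_mul, hφl, hφr]
      simpa using SetLike.mul_mem_graded (hf c) (hg hu)
    · rw [map_add]
      exact add_mem hx hy
  · refine (hgι _).trans ?_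
    simp [l, Fintype.linearCombination_apply_single]

end grassmannExt

/-! ### Morphisms to super Weil algebras -/

namespace SWA

variable {A B : SWA}

theorem mem_nilIdeal_iff {a : A.obj} : a ∈ A.nilIdeal ↔ A.body a = 0 := by
  refine ⟨fun h => (A.existsUnique_body a).unique (A.nilPart_mem a) (by simpa using h), fun h => ?_⟩
  simpa [nilPart, h] using A.nilPart_mem a

theorem isNilpotent_of_mem {a : A.obj} (ha : a ∈ A.nilIdeal) : IsNilpotent a := by
  obtain ⟨K, hK⟩ := A.nilIdeal_nilpotent
  refine ⟨K, ?_⟩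
  have : a ^ K ∈ A.nilIdeal ^ K := Submodule.pow_mem_pow _ ha K
  rw [hK] at this
  exact this

/-- A real character kills nilpotents, and every element is a scalar plus a nilpotent. In particular
all morphisms preserve bodies. -/
theorem algHom_eq_body (χ : A.obj →ₐ[ℝ] ℝ) : χ = A.body := by
  refine AlgHom.ext fun a => ?_
  have h := ((isNilpotent_of_mem (A.nilPart_mem a)).map χ).eq_zero
  rw [nilPart, map_sub, AlgHom.commutes] at h
  exact sub_eq_zero.1 h

theorem body_toAlgHom (ρ : A.obj ⟶ B.obj) (a : A.obj) :
    B.body (SuperAlg.toAlgHom ρ a) = A.body a :=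
  congrArg (fun χ => χ a) (algHom_eq_body (B.body.comp (SuperAlg.toAlgHom ρ)))

theorem toAlgHom_nilPart (ρ : A.obj ⟶ B.obj) (a : A.obj) :
    SuperAlg.toAlgHom ρ (A.nilPart a) = B.nilPart (SuperAlg.toAlgHom ρ a) := by
  rw [nilPart, nilPart, body_toAlgHom, map_sub, AlgHom.commutes]

theorem body_odd {a : A.obj} (ha : a ∈ A.obj.part 1) : A.body a = 0 := by
  have h := congrArg A.body (SuperAlg.odd_mul_self ha)
  rw [map_mul, map_zero] at h
  exact mul_self_eq_zero.1 h

end SWA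

/-! ### Points of a superdomain and their coordinates. -/

section Points

variable {p q : ℕ} {U : Opens (Fin p → ℝ)} {A B : SWA}

theorem evenCoord_eq (i : Fin p) :
    evenCoord U q i = grassmannExt.inl (SmoothFun U) q (SmoothFun.coord U i) := rfl

theorem body_inl (x : sections U q ⟶ A.obj) (f : SmoothFun U) :
    A.body (SuperAlg.toAlgHom x (grassmannExt.inl _ q f)) = f (basePoint x) := by
  have h := congrArg (fun χ => χ (grassmannExt.inl _ q f)) (body_comp_eq_evalAt x)
  refine Eq.trans h ((Algebra.TensorProduct.lift_tmul _ _ _ _ _).trans ?_)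
  rw [map_one, mul_one]
  rfl

theorem basePoint_comp (x : sections U q ⟶ A.obj) (ρ : A.obj ⟶ B.obj) :
    basePoint (x ≫ ρ) = basePoint x :=
  Subtype.ext (funext fun _ => SWA.body_toAlgHom ρ _)

/-- By `body_inl`, a function vanishing at the base point has an image with body `0`; products then
give the powers. -/
theorem inl_mem_nilIdeal_pow (x : sections U q ⟶ A.obj) (K : ℕ) : ∀ {f : SmoothFun U},
    f ∈ SmoothFun.vanishing (basePoint x) ^ K →
      SuperAlg.toAlgHom x (grassmannExt.inl _ q f) ∈ A.nilIdeal ^ K := by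
  induction K with
  | zero => intro f _; rw [Submodule.pow_zero, Ideal.one_eq_top]; trivial
  | succ K ih =>
    intro f hf
    rw [pow_succ] at hf
    rw [Submodule.pow_succ]
    induction hf using Submodule.mul_induction_on' with
    | mem_mul_mem f hf g hg =>
      rw [map_mul, map_mul]
      exact Ideal.mul_mem_mul (ih hf) (SWA.mem_nilIdeal_iff.2 ((body_inl x g).trans hg))
    | add f _ g _ hf hg => rw [map_add, map_add]; exact Ideal.add_mem _ hf hg

theorem exists_inl_eq_zero (x : sections U q ⟶ A.obj) :
    ∃ K, ∀ f ∈ SmoothFun.vanishing (basePoint x) ^ K,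
      SuperAlg.toAlgHom x (grassmannExt.inl _ q f) = 0 := by
  obtain ⟨K, hK⟩ := A.nilIdeal_nilpotent
  refine ⟨K, fun f hf => ?_⟩
  have h := inl_mem_nilIdeal_pow x K hf
  rw [hK] at h
  exact h

/-- A morphism to a super Weil algebra is determined by its values on the coordinates. -/
theorem sections_hom_ext {x x' : sections U q ⟶ A.obj}
    (he : ∀ i, SuperAlg.toAlgHom x (evenCoord U q i) = SuperAlg.toAlgHom x' (evenCoord U q i))
    (ho : ∀ j, SuperAlg.toAlgHom x (oddCoord U q j) = SuperAlg.toAlgHom x' (oddCoord U q j)) :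
    x = x' := by
  have hb : basePoint x' = basePoint x :=
    Subtype.ext (funext fun i => congrArg A.body (he i).symm)
  refine grassmannExt.hom_ext (fun f => ?_) ho
  obtain ⟨K, hK⟩ := exists_inl_eq_zero x
  obtain ⟨K', hK'⟩ := exists_inl_eq_zero x'
  rw [hb] at hK'
  -- A Taylor polynomial at the common base point, of an order high enough for both morphisms to
  -- kill the remainder. On polynomials they agree by `he`.
  obtain ⟨P, hP⟩ := SmoothFun.exists_sub_ofPolynomial_mem (basePoint x) (max K K') f
  have h1 := hK _ (Ideal.pow_le_pow_right (le_max_left _ _) hP)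
  have h2 := hK' _ (Ideal.pow_le_pow_right (le_max_right _ _) hP)
  rw [map_sub, map_sub, sub_eq_zero] at h1 h2
  rw [h1, h2]
  have h3 : ((SuperAlg.toAlgHom x).comp (grassmannExt.inl _ q)).comp
        (SmoothFun.ofPolynomial (basePoint x)) =
      ((SuperAlg.toAlgHom x').comp (grassmannExt.inl _ q)).comp
        (SmoothFun.ofPolynomial (basePoint x)) := by
    refine MvPolynomial.algHom_ext fun i => ?_
    simp only [AlgHom.comp_apply, SmoothFun.ofPolynomial, MvPolynomial.aeval_X,
      SmoothFun.centeredCoord, map_sub, AlgHom.commutes]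
    rw [← evenCoord_eq, he]
  exact congrArg (fun φ => φ P) h3

/-- Existence of morphisms to a super Weil algebra with prescribed values on the coordinates. -/
theorem exists_sections_hom (a : Fin p → A.obj) (b : Fin q → A.obj)
    (ha : ∀ i, a i ∈ A.obj.part 0) (hb : ∀ j, b j ∈ A.obj.part 1)
    (hU : (fun i => A.body (a i)) ∈ U) :
    ∃ x : sections U q ⟶ A.obj, (∀ i, SuperAlg.toAlgHom x (evenCoord U q i) = a i) ∧
      ∀ j, SuperAlg.toAlgHom x (oddCoord U q j) = b j := by
  let y : U := ⟨_, hU⟩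
  obtain ⟨K, hK⟩ := A.nilIdeal_nilpotent
  let n : Fin p → A.obj.evenPart := fun i =>
    ⟨a i, ha i⟩ - algebraMap ℝ _ (A.body (a i))
  -- `nilIdeal` lives in the noncommutative algebra; `I` is its trace on the even part. Its `K`-th
  -- power vanishes, so `n` satisfies the relations of the jet algebra.
  let I : Ideal A.obj.evenPart :=
    RingHom.ker (A.body.comp A.obj.evenPart.val)
  have hI (k : ℕ) : ∀ c ∈ I ^ k, (c : A.obj) ∈ A.nilIdeal ^ k := by
    induction k with
    | zero => intro c _; rw [Submodule.pow_zero, Ideal.one_eq_top]; trivial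
    | succ k ih =>
      intro c hc
      rw [pow_succ] at hc
      rw [Submodule.pow_succ]
      induction hc using Submodule.mul_induction_on' with
      | mem_mul_mem c hc d hd =>
        exact Ideal.mul_mem_mul (ih c hc) (SWA.mem_nilIdeal_iff.2 hd)
      | add c _ d _ hc hd => exact Ideal.add_mem _ hc hd
  have hn (i : Fin p) : n i ∈ I := by
    refine RingHom.mem_ker.2 ?_
    change A.body (a i - algebraMap ℝ _ (A.body (a i))) = 0
    rw [map_sub, AlgHom.commutes]
    exact sub_self _
  obtain ⟨g, hg⟩ := Jet.exists_lift (y := y) (K := K) n fun P hP => by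
    have h := hI K _ (MvPolynomial.aeval_mem_pow hn hP)
    rw [hK] at h
    exact Subtype.ext h
  let f : SmoothFun U →ₐ[ℝ] A.obj :=
    A.obj.evenPart.val.comp (g.comp (Ideal.Quotient.mkₐ ℝ (SmoothFun.vanishing y ^ K)))
  obtain ⟨x, hx, hx'⟩ := grassmannExt.exists_hom f (fun c => Subtype.property _) b hb
  refine ⟨x, fun i => ?_, hx'⟩
  rw [evenCoord_eq, hx]
  have h1 := hg (MvPolynomial.X i)
  rw [Jet.ofPolynomial, SmoothFun.ofPolynomial, AlgHom.comp_apply, MvPolynomial.aeval_X,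
    MvPolynomial.aeval_X] at h1
  have h2 : f (SmoothFun.centeredCoord y i) = a i - algebraMap ℝ _ (A.body (a i)) :=
    congrArg Subtype.val h1
  rw [SmoothFun.centeredCoord, map_sub, AlgHom.commutes] at h2
  exact sub_left_injective h2

end Points

/-! ### Grassmann extensions of Weil algebras -/

namespace Grassmann

variable {q : ℕ}

theorem monomialBasis_mem (J : Finset (Fin q)) :
    monomialBasis q J ∈ parity q (J.card : ZMod 2) := by
  have h (l : List (Fin q)) : (l.map gen).prod ∈ parity q (l.length : ZMod 2) := by
    induction l with
    | nil =>
      rw [List.map_nil, List.prod_nil, List.length_nil, Nat.cast_zero]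
      exact SetLike.GradedOne.one_mem
    | cons j l ih =>
      rw [List.map_cons, List.prod_cons, List.length_cons, Nat.cast_add, Nat.cast_one, add_comm]
      exact SetLike.mul_mem_graded (gen_mem j) ih
  rw [monomialBasis_apply]
  have hJ := h J.sort
  rwa [Finset.length_sort] at hJ

theorem isNilpotent_sub_algebraMapInv {u : Grassmann q} (hu : u ∈ parity q 0) :
    IsNilpotent (u - algebraMap ℝ _ (ExteriorAlgebra.algebraMapInv u)) := by
  have hι (v : Fin q → ℝ) : ExteriorAlgebra.algebraMapInv
      (CliffordAlgebra.ι (0 : QuadraticForm ℝ (Fin q → ℝ)) v) = (0 : ℝ) := by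
    have h := congrArg (ExteriorAlgebra.algebraMapInv (R := ℝ) (M := Fin q → ℝ))
      (ExteriorAlgebra.ι_sq_zero (R := ℝ) v)
    rw [map_mul, map_zero] at h
    exact mul_self_eq_zero.1 h
  induction u, hu using CliffordAlgebra.even_induction with
  | algebraMap r =>
    refine ⟨1, ?_⟩
    rw [pow_one, AlgHom.commutes]
    exact sub_self _
  | add x y hx hy ihx ihy =>
    rw [map_add, map_add, add_sub_add_comm]
    refine Commute.isNilpotent_add ?_ ihx ihy
    exact even_mul (sub_mem hx (SetLike.algebraMap_mem_graded _ _)) _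
  | ι_mul_ι_mul v w x hx ih =>
    have h0 : ExteriorAlgebra.algebraMapInv (CliffordAlgebra.ι (0 : QuadraticForm ℝ _) v *
        CliffordAlgebra.ι (0 : QuadraticForm ℝ _) w * x) = (0 : ℝ) := by
      rw [map_mul, map_mul, hι, zero_mul, zero_mul]
    rw [h0, map_zero, sub_zero]
    have h1 : CliffordAlgebra.ι (0 : QuadraticForm ℝ (Fin q → ℝ)) w *
        CliffordAlgebra.ι (0 : QuadraticForm ℝ (Fin q → ℝ)) w = 0 :=
      ExteriorAlgebra.ι_sq_zero (R := ℝ) w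
    -- Commuting `v w` past `w` gives `w v w = v w w = 0`, which kills the square of `v w x`.
    have h2 := ι_mul_ι_mul v w (CliffordAlgebra.ι (0 : QuadraticForm ℝ (Fin q → ℝ)) w)
    have h3 := ι_mul_ι_mul v w x
    generalize CliffordAlgebra.ι (0 : QuadraticForm ℝ (Fin q → ℝ)) v = a at h2 h3 ⊢
    generalize CliffordAlgebra.ι (0 : QuadraticForm ℝ (Fin q → ℝ)) w = b at h1 h2 h3 ⊢
    rw [mul_assoc, h1, mul_zero] at h2
    refine ⟨2, ?_⟩
    rw [sq, ← mul_assoc, mul_assoc (a * b), ← h3, ← mul_assoc (a * b), mul_assoc a b (a * b), ← h2,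
      mul_zero, zero_mul, zero_mul]

end Grassmann

/-- A nil left ideal lies in the Jacobson radical, since each `1 + b a` is a unit, and this radical
is nilpotent in an Artinian ring. -/
theorem Ideal.isNilpotent_of_forall_isNilpotent {R : Type} [Ring R] [IsArtinianRing R]
    {N : Ideal R} (hN : ∀ a ∈ N, IsNilpotent a) : IsNilpotent N := by
  have hle : N ≤ Ring.jacobson R := by
    rw [← Ideal.jacobson_bot]
    intro a ha
    refine Ideal.mem_jacobson_iff.2 fun b => ?_
    obtain ⟨u, hu⟩ := (hN (b * a) (N.mul_mem_left b ha)).isUnit_add_one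
    refine ⟨↑u⁻¹, ?_⟩
    rw [mul_assoc, ← mul_add_one, ← hu, Units.inv_mul, sub_self]
    exact Ideal.zero_mem _
  obtain ⟨k, hk⟩ := IsSemiprimaryRing.isNilpotent (R := R)
  have hpow (k : ℕ) : N ^ k ≤ Ring.jacobson R ^ k := by
    induction k with
    | zero => rw [Submodule.pow_zero, Submodule.pow_zero]
    | succ k ih =>
      rw [Submodule.pow_succ, Submodule.pow_succ]
      exact Submodule.mul_le.2 fun a ha b hb => Submodule.mul_mem_mul (ih ha) (hle hb)
  exact ⟨k, le_bot_iff.1 ((hpow k).trans hk.le)⟩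

/-! ### Components along the odd monomials, and the super Weil property. -/

namespace grassmannExt

variable {C : Type} [CommRing C] [Algebra ℝ C] {q : ℕ}

/-- The coefficient in `C` of a monomial in the odd generators. -/
def comp (J : Finset (Fin q)) (z : grassmannExt C q) : C :=
  ((Grassmann.monomialBasis q).baseChange C).repr z J

theorem sum_inl_mul_inr (c : Finset (Fin q) → C) :
    (∑ J, inl C q (c J) * inr C q (Grassmann.monomialBasis q J) : grassmannExt C q) =
      (∑ J, c J • (Grassmann.monomialBasis q).baseChange C J : C ⊗[ℝ] Grassmann q) := by
  refine Finset.sum_congr rfl fun J _ => ?_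
  rw [← tmul_eq, Module.Basis.baseChange_apply, TensorProduct.smul_tmul', smul_eq_mul, mul_one]

theorem eq_sum (z : grassmannExt C q) :
    z = ∑ J, inl C q (comp J z) * inr C q (Grassmann.monomialBasis q J) := by
  rw [sum_inl_mul_inr]
  exact (((Grassmann.monomialBasis q).baseChange C).sum_repr z).symm

theorem comp_sum (c : Finset (Fin q) → C) (J : Finset (Fin q)) :
    comp J (∑ J, inl C q (c J) * inr C q (Grassmann.monomialBasis q J)) = c J := by
  rw [sum_inl_mul_inr]
  exact congrFun (((Grassmann.monomialBasis q).baseChange C).repr_sum_self c) J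

theorem inl_mul_inr_mem (c : C) (J : Finset (Fin q)) :
    inl C q c * inr C q (Grassmann.monomialBasis q J) ∈
      (grassmannExt C q).part (J.card : ZMod 2) := by
  simpa using SetLike.mul_mem_graded (inl_mem (q := q) c)
    (inr_mem (C := C) (Grassmann.monomialBasis_mem J))

theorem sum_mem_part {i : ZMod 2} {c : Finset (Fin q) → C}
    (hc : ∀ J, (J.card : ZMod 2) ≠ i → c J = 0) :
    ∑ J, inl C q (c J) * inr C q (Grassmann.monomialBasis q J) ∈ (grassmannExt C q).part i := by
  refine Submodule.sum_mem _ fun J _ => ?_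
  by_cases h : (J.card : ZMod 2) = i
  · exact h ▸ inl_mul_inr_mem (c J) J
  · rw [hc J h, map_zero, zero_mul]
    exact zero_mem _

/-- Split the expansion of `z` by the parity of `J`. The terms of wrong parity sum to an element of
both graded parts, hence to `0`, and their coefficients vanish. -/
theorem comp_eq_zero {i : ZMod 2} {z : grassmannExt C q} (hz : z ∈ (grassmannExt C q).part i)
    {J : Finset (Fin q)} (hJ : (J.card : ZMod 2) ≠ i) : comp J z = 0 := by
  have hpar {J : Finset (Fin q)} : (J.card : ZMod 2) ≠ i + 1 → (J.card : ZMod 2) = i := by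
    generalize (J.card : ZMod 2) = k
    clear hz hJ
    revert i k
    decide
  let c : Finset (Fin q) → C := fun J => if (J.card : ZMod 2) = i then comp J z else 0
  let c' : Finset (Fin q) → C := fun J => if (J.card : ZMod 2) = i then 0 else comp J z
  have hc : ∑ J, inl C q (c J) * inr C q (Grassmann.monomialBasis q J) ∈
      (grassmannExt C q).part i := sum_mem_part fun J hJ => if_neg hJ
  have hc' : ∑ J, inl C q (c' J) * inr C q (Grassmann.monomialBasis q J) ∈
      (grassmannExt C q).part (i + 1) := sum_mem_part fun J hJ => if_pos (hpar hJ)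
  have hadd : z = ∑ J, inl C q (c J) * inr C q (Grassmann.monomialBasis q J) +
      ∑ J, inl C q (c' J) * inr C q (Grassmann.monomialBasis q J) := by
    rw [← Finset.sum_add_distrib]
    conv_lhs => rw [eq_sum z]
    refine Finset.sum_congr rfl fun J _ => ?_
    rw [← add_mul, ← map_add]
    congr 2
    by_cases h : (J.card : ZMod 2) = i <;> simp [c, c', h]
  have h0 : ∑ J, inl C q (c' J) * inr C q (Grassmann.monomialBasis q J) = 0 := by
    have hdis : Disjoint ((grassmannExt C q).part i) ((grassmannExt C q).part (i + 1)) :=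
      (DirectSum.Decomposition.isInternal (grassmannExt C q).part).submodule_iSupIndep
        |>.pairwiseDisjoint (by simp)
    refine Submodule.disjoint_def.1 hdis _ ?_ hc'
    rw [← sub_eq_of_eq_add' hadd]
    exact sub_mem hz hc
  have h1 := comp_sum c' J
  rw [h0] at h1
  have h2 : comp J (0 : grassmannExt C q) = 0 := by
    change (((Grassmann.monomialBasis q).baseChange C).repr (0 : C ⊗[ℝ] Grassmann q)) J = 0
    rw [map_zero]
    rfl
  rw [h2] at h1
  exact (if_neg hJ).symm.trans h1.symm

theorem toAlgHom_inr {D : Type} [CommRing D] [Algebra ℝ D]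
    (x : grassmannExt C q ⟶ grassmannExt D q)
    (hx : ∀ j, SuperAlg.toAlgHom x (inr C q (Grassmann.gen j)) = inr D q (Grassmann.gen j))
    (u : Grassmann q) : SuperAlg.toAlgHom x (inr C q u) = inr D q u := by
  have h : (SuperAlg.toAlgHom x).comp (inr C q) = inr D q := by
    refine ExteriorAlgebra.hom_ext (LinearMap.pi_ext' fun j => LinearMap.ext_ring ?_)
    exact hx j
  exact congrArg (fun φ => φ u) h

/-- The nilpotent ideal is the kernel of the augmentation `ε`. Its even elements are nilpotent, odd
elements square to zero, and finite dimension turns a nil ideal into a nilpotent one. -/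
theorem isSuperWeil [Module.Finite ℝ C] (χ : C →ₐ[ℝ] ℝ)
    (hχ : ∀ c, χ c = 0 → IsNilpotent c) : IsSuperWeil (grassmannExt C q) := by
  have hG : Module.Finite ℝ (Grassmann q) := .of_basis (Grassmann.monomialBasis q)
  have hfin : Module.Finite ℝ (grassmannExt C q) :=
    (inferInstance : Module.Finite ℝ (C ⊗[ℝ] Grassmann q))
  have : IsArtinianRing (grassmannExt C q) := .of_finite ℝ _
  let ε : grassmannExt C q →ₐ[ℝ] ℝ :=
    (Algebra.TensorProduct.lift χ ExteriorAlgebra.algebraMapInv (fun _ _ => Commute.all _ _) :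
      C ⊗[ℝ] Grassmann q →ₐ[ℝ] ℝ)
  have hεl (c : C) : ε (inl C q c) = χ c :=
    (Algebra.TensorProduct.lift_tmul _ _ _ _ _).trans (by rw [map_one, mul_one])
  have hεr (u : Grassmann q) : ε (inr C q u) = ExteriorAlgebra.algebraMapInv u :=
    (Algebra.TensorProduct.lift_tmul _ _ _ _ _).trans (by rw [map_one, one_mul])
  have hodd {a : grassmannExt C q} (ha : a ∈ (grassmannExt C q).part 1) : ε a = 0 := by
    have h := congrArg ε (SuperAlg.odd_mul_self ha)
    rw [map_mul, map_zero] at h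
    exact mul_self_eq_zero.1 h
  have heven (a : grassmannExt C q) (ha : a ∈ (grassmannExt C q).part 0) :
      IsNilpotent (a - algebraMap ℝ _ (ε a)) := by
    refine part_induction (motive := fun a => IsNilpotent (a - algebraMap ℝ _ (ε a))) ?_
      (fun c u hu => ?_) (fun x hx y hy ihx ihy => ?_) a ha
    · rw [map_zero, map_zero, sub_zero]
      exact IsNilpotent.zero
    · have h : inl C q c * inr C q u - algebraMap ℝ _ (ε (inl C q c * inr C q u)) =
          inl C q (c - algebraMap ℝ _ (χ c)) * inr C q u +
            inl C q (algebraMap ℝ _ (χ c)) *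
              inr C q (u - algebraMap ℝ _ (ExteriorAlgebra.algebraMapInv u)) := by
        simp only [map_sub, map_mul, AlgHom.commutes, hεl, hεr, sub_mul, mul_sub]
        abel
      rw [h]
      have hc : IsNilpotent (c - algebraMap ℝ C (χ c)) :=
        hχ _ (by rw [map_sub, AlgHom.commutes]; exact sub_self _)
      refine Commute.isNilpotent_add ?_ ?_ ?_
      · refine SuperAlg.even_commute ?_ _
        simpa using SetLike.mul_mem_graded (inl_mem (q := q) (c - algebraMap ℝ C (χ c)))
          (inr_mem (C := C) hu)
      · exact (SuperAlg.even_commute (inl_mem _) _).isNilpotent_mul_right (hc.map (inl C q))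
      · exact (SuperAlg.even_commute (inl_mem _) _).isNilpotent_mul_left
          ((Grassmann.isNilpotent_sub_algebraMapInv hu).map (inr C q))
    · rw [map_add, map_add, add_sub_add_comm]
      refine Commute.isNilpotent_add (SuperAlg.even_commute ?_ _) ihx ihy
      exact sub_mem hx (SetLike.algebraMap_mem_graded _ _)
  have hdec (a : grassmannExt C q) : ∃ a₀ ∈ (grassmannExt C q).part 0,
      ∃ a₁ ∈ (grassmannExt C q).part 1, a = a₀ + a₁ := by
    induction a using DirectSum.Decomposition.inductionOn (grassmannExt C q).part with
    | zero => exact ⟨0, zero_mem _, 0, zero_mem _, (add_zero 0).symm⟩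
    | @homogeneous i b =>
      obtain ⟨b, hb⟩ := b
      fin_cases i
      · exact ⟨b, hb, 0, zero_mem _, (add_zero b).symm⟩
      · exact ⟨0, zero_mem _, b, hb, (zero_add b).symm⟩
    | add a b ha hb =>
      obtain ⟨a₀, ha₀, a₁, ha₁, rfl⟩ := ha
      obtain ⟨b₀, hb₀, b₁, hb₁, rfl⟩ := hb
      exact ⟨_, add_mem ha₀ hb₀, _, add_mem ha₁ hb₁, add_add_add_comm _ _ _ _⟩
  refine ⟨hfin, RingHom.ker ε, ?_, Ideal.isNilpotent_of_forall_isNilpotent fun a ha => ?_,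
    fun a => ⟨ε a, ?_, fun r hr => ?_⟩⟩
  · intro i a ha
    obtain ⟨a₀, ha₀, a₁, ha₁, rfl⟩ := hdec a
    have h0 : ε a₀ = 0 := by
      have h := RingHom.mem_ker.1 ha
      rwa [map_add, hodd ha₁, add_zero] at h
    rw [RingHom.mem_ker, DirectSum.decompose_add, DirectSum.add_apply, Submodule.coe_add]
    obtain rfl | rfl : i = 0 ∨ i = 1 := by
      clear ha
      revert i
      decide
    · rw [DirectSum.decompose_of_mem_same _ ha₀, DirectSum.decompose_of_mem_ne _ ha₁ one_ne_zero,
        add_zero, h0]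
    · rw [DirectSum.decompose_of_mem_same _ ha₁, DirectSum.decompose_of_mem_ne _ ha₀ zero_ne_one,
        zero_add, hodd ha₁]
  · obtain ⟨a₀, ha₀, a₁, ha₁, rfl⟩ := hdec a
    have h0 : ε a₀ = 0 := by
      have h := RingHom.mem_ker.1 ha
      rwa [map_add, hodd ha₁, add_zero] at h
    have h1 := heven a₀ ha₀
    rw [h0, map_zero, sub_zero] at h1
    exact Commute.isNilpotent_add (SuperAlg.even_commute ha₀ _) h1
      ⟨2, by rw [sq, SuperAlg.odd_mul_self ha₁]⟩
  · refine RingHom.mem_ker.2 ?_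
    rw [map_sub, AlgHom.commutes]
    exact sub_self _
  · have h := RingHom.mem_ker.1 hr
    rw [map_sub, AlgHom.commutes] at h
    exact (sub_eq_zero.1 h).symm

end grassmannExt

/-! ### Jet algebras and generic points -/

namespace Jet

variable {p : ℕ} {U : Opens (Fin p → ℝ)}

/-- The value of a jet at its base point. -/
def value (y : U) (K : ℕ) : Jet y (K + 1) →ₐ[ℝ] ℝ :=
  Ideal.Quotient.liftₐ _ ((Pi.evalAlgHom ℝ (fun _ : U => ℝ) y).comp ContMDiffMap.coeFnAlgHom)
    -- The exponent `K + 1` is nonzero, so the ideal divided out vanishes at `y`; with exponent `0`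
    -- the quotient would be the zero ring.
    fun _ hf => Ideal.pow_le_self K.succ_ne_zero hf

theorem isNilpotent_of_value_eq_zero {y : U} {K : ℕ} {c : Jet y (K + 1)} (hc : value y K c = 0) :
    IsNilpotent c := by
  obtain ⟨f, rfl⟩ := Ideal.Quotient.mk_surjective c
  refine ⟨K + 1, ?_⟩
  rw [← map_pow]
  exact Ideal.Quotient.eq_zero_iff_mem.2 (Ideal.pow_mem_pow hc _)

end Jet

/-- The super Weil algebra of jets of order at most `K` at `y`. -/
def jetAlg {p : ℕ} {U : Opens (Fin p → ℝ)} (y : U) (K q : ℕ) : SWA :=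
  ⟨grassmannExt (Jet y (K + 1)) q,
    grassmannExt.isSuperWeil (Jet.value y K) fun _ => Jet.isNilpotent_of_value_eq_zero⟩

section Generic

variable {p : ℕ} {U : Opens (Fin p → ℝ)} {y : U} {K q : ℕ}

theorem exists_jetPoint (y : U) (K q : ℕ) : ∃ x : sections U q ⟶ (jetAlg y K q).obj,
    (∀ f, SuperAlg.toAlgHom x (grassmannExt.inl _ q f) =
      grassmannExt.inl (Jet y (K + 1)) q (Ideal.Quotient.mk _ f)) ∧
    ∀ j, SuperAlg.toAlgHom x (grassmannExt.inr _ q (Grassmann.gen j)) =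
      grassmannExt.inr (Jet y (K + 1)) q (Grassmann.gen j) :=
  grassmannExt.exists_hom (A := grassmannExt (Jet y (K + 1)) q)
    ((grassmannExt.inl _ q).comp (Ideal.Quotient.mkₐ ℝ _))
    (fun _ => grassmannExt.inl_mem _) (fun j => grassmannExt.inr _ q (Grassmann.gen j))
    fun j => grassmannExt.inr_mem (Grassmann.gen_mem j)

/-- The point of `U` given by the jets of functions at `y`. -/
def jetPoint (y : U) (K q : ℕ) : sections U q ⟶ (jetAlg y K q).obj :=
  (exists_jetPoint y K q).choose

theorem jetPoint_inl (f : SmoothFun U) :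
    SuperAlg.toAlgHom (jetPoint y K q) (grassmannExt.inl _ q f) =
      grassmannExt.inl (Jet y (K + 1)) q (Ideal.Quotient.mk _ f) :=
  (exists_jetPoint y K q).choose_spec.1 f

theorem jetPoint_inr (u : Grassmann q) :
    SuperAlg.toAlgHom (jetPoint y K q) (grassmannExt.inr _ q u) =
      grassmannExt.inr (Jet y (K + 1)) q u :=
  grassmannExt.toAlgHom_inr _ (exists_jetPoint y K q).choose_spec.2 u

/-- `body` depends on a chosen ideal, so it does not unfold to `Jet.value`. They agree because `c`
minus its value is nilpotent. -/
theorem body_jetAlg_inl (c : Jet y (K + 1)) :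
    (jetAlg y K q).body (grassmannExt.inl _ q c : grassmannExt (Jet y (K + 1)) q) =
      Jet.value y K c := by
  let φ : Jet y (K + 1) →ₐ[ℝ] ℝ := (jetAlg y K q).body.comp (grassmannExt.inl (Jet y (K + 1)) q)
  have h : IsNilpotent (c - algebraMap ℝ _ (Jet.value y K c)) :=
    Jet.isNilpotent_of_value_eq_zero (by rw [map_sub, AlgHom.commutes]; exact sub_self _)
  have h0 := (h.map φ).eq_zero
  rw [map_sub, AlgHom.commutes] at h0
  exact sub_eq_zero.1 h0

theorem basePoint_jetPoint : basePoint (jetPoint y K q) = y := by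
  refine Subtype.ext (funext fun i => ?_)
  change (jetAlg y K q).body (SuperAlg.toAlgHom (jetPoint y K q) (evenCoord U q i)) = _
  rw [evenCoord_eq, jetPoint_inl, body_jetAlg_inl]
  rfl

theorem nilPart_jetPoint (i : Fin p) :
    (jetAlg y K q).nilPart (SuperAlg.toAlgHom (jetPoint y K q) (evenCoord U q i)) =
      grassmannExt.inl (Jet y (K + 1)) q (Jet.ofPolynomial y (K + 1) (MvPolynomial.X i)) := by
  rw [SWA.nilPart, evenCoord_eq, jetPoint_inl, body_jetAlg_inl, Jet.ofPolynomial,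
    SmoothFun.ofPolynomial, AlgHom.comp_apply, MvPolynomial.aeval_X, SmoothFun.centeredCoord,
    map_sub, map_sub, AlgHom.commutes, AlgHom.commutes]
  rfl

/-- Every point of `U` with values in a super Weil algebra is induced by a generic point. -/
theorem exists_jetPoint_comp {A : SWA} (x : sections U q ⟶ A.obj) :
    ∃ (K : ℕ) (ρ : (jetAlg (basePoint x) K q).obj ⟶ A.obj),
      jetPoint (basePoint x) K q ≫ ρ = x := by
  obtain ⟨K, hK⟩ := exists_inl_eq_zero x
  -- `x` kills the `K`-th power of the vanishing ideal, hence also the power `K + 1` divided out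
  -- here.
  let f : Jet (basePoint x) (K + 1) →ₐ[ℝ] A.obj :=
    Ideal.Quotient.liftₐ _ ((SuperAlg.toAlgHom x).comp (grassmannExt.inl _ q))
      fun f hf => hK f (Ideal.pow_le_pow_right K.le_succ hf)
  obtain ⟨ρ, hl, hr⟩ := grassmannExt.exists_hom f (fun c => by
      obtain ⟨g, rfl⟩ := Ideal.Quotient.mk_surjective c
      exact SuperAlg.toAlgHom_mem x (grassmannExt.inl_mem g))
    (fun j => SuperAlg.toAlgHom x (oddCoord U q j))
    fun j => SuperAlg.toAlgHom_mem x (grassmannExt.inr_mem (Grassmann.gen_mem j))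
  refine ⟨K, ρ, grassmannExt.hom_ext (fun g => ?_) fun j => ?_⟩
  · exact (congrArg (SuperAlg.toAlgHom ρ) (jetPoint_inl g)).trans (hl _)
  · exact (congrArg (SuperAlg.toAlgHom ρ) (jetPoint_inr _)).trans (hr j)

/-- Truncation of jets. -/
theorem exists_truncation (y : U) (q : ℕ) {K K' : ℕ} (h : K ≤ K') :
    ∃ π : (jetAlg y K' q).obj ⟶ (jetAlg y K q).obj,
      jetPoint y K' q ≫ π = jetPoint y K q ∧
      (∀ P, SuperAlg.toAlgHom π (grassmannExt.inl _ q (Jet.ofPolynomial y (K' + 1) P)) =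
        grassmannExt.inl _ q (Jet.ofPolynomial y (K + 1) P)) ∧
      ∀ u, SuperAlg.toAlgHom π (grassmannExt.inr (Jet y (K' + 1)) q u) =
        grassmannExt.inr (Jet y (K + 1)) q u := by
  let f : Jet y (K' + 1) →ₐ[ℝ] Jet y (K + 1) :=
    Ideal.Quotient.factorₐ ℝ (Ideal.pow_le_pow_right (Nat.succ_le_succ h))
  obtain ⟨π, hl, hr⟩ := grassmannExt.exists_hom (A := grassmannExt (Jet y (K + 1)) q)
    ((grassmannExt.inl _ q).comp f) (fun _ => grassmannExt.inl_mem _)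
    (fun j => grassmannExt.inr _ q (Grassmann.gen j))
    fun j => grassmannExt.inr_mem (Grassmann.gen_mem j)
  refine ⟨π, grassmannExt.hom_ext (fun g => ?_) fun j => ?_, fun P => hl _,
    grassmannExt.toAlgHom_inr π hr⟩
  · exact (congrArg (SuperAlg.toAlgHom π) (jetPoint_inl g)).trans
      ((hl _).trans (jetPoint_inl g).symm)
  · exact (congrArg (SuperAlg.toAlgHom π) (jetPoint_inr _)).trans
      ((hr j).trans (jetPoint_inr _).symm)

end Generic

/-! ### Evaluation of formal series -/

namespace FormalSeries

variable {p q : ℕ} {U : Opens (Fin p → ℝ)} {A B : SWA}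

theorem coeff_eq_zero {F : FormalSeries U q} {i : ZMod 2} (hF : F ∈ (FormalSeries U q).part i)
    (ν : Fin p →₀ ℕ) {J : Finset (Fin q)} (hJ : (J.card : ZMod 2) ≠ i) : coeff F ν J = 0 := by
  have h : grassmannExt.comp J F = 0 := grassmannExt.comp_eq_zero hF hJ
  change MvPowerSeries.coeff ν (grassmannExt.comp J F) = 0
  rw [h, map_zero]

theorem ext_coeff {F G : FormalSeries U q} (h : ∀ ν J, coeff F ν J = coeff G ν J) : F = G := by
  rw [grassmannExt.eq_sum F, grassmannExt.eq_sum G]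
  refine Finset.sum_congr rfl fun J _ => ?_
  congr 2
  exact MvPowerSeries.ext fun ν => h ν J

/-- The formal series with given coefficients. -/
def ofCoeff (c : (Fin p →₀ ℕ) → Finset (Fin q) → U → ℝ) : FormalSeries U q :=
  ∑ J, grassmannExt.inl (MvPowerSeries (Fin p) (U → ℝ)) q (fun ν => c ν J) *
    grassmannExt.inr _ q (Grassmann.monomialBasis q J)

theorem coeff_ofCoeff (c : (Fin p →₀ ℕ) → Finset (Fin q) → U → ℝ) (ν : Fin p →₀ ℕ)
    (J : Finset (Fin q)) : coeff (ofCoeff c) ν J = c ν J :=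
  congrArg (MvPowerSeries.coeff ν)
    (grassmannExt.comp_sum (C := MvPowerSeries (Fin p) (U → ℝ)) (fun J ν => c ν J) J)

theorem ofCoeff_mem {c : (Fin p →₀ ℕ) → Finset (Fin q) → U → ℝ} {i : ZMod 2}
    (hc : ∀ ν J, (J.card : ZMod 2) ≠ i → c ν J = 0) :
    ofCoeff c ∈ (FormalSeries U q).part i :=
  grassmannExt.sum_mem_part fun J hJ => funext fun ν => hc ν J hJ

theorem toAlgHom_monomial (x : sections U q ⟶ A.obj) (ρ : A.obj ⟶ B.obj) (ν : Fin p →₀ ℕ)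
    (J : Finset (Fin q)) :
    SuperAlg.toAlgHom ρ (monomial x ν J) = monomial (x ≫ ρ) ν J := by
  simp only [monomial, map_mul, map_list_prod, List.map_map, Function.comp_def, map_pow,
    SWA.toAlgHom_nilPart, SuperAlg.toAlgHom_comp, AlgHom.comp_apply]

theorem monomial_mem (x : sections U q ⟶ A.obj) (ν : Fin p →₀ ℕ) (J : Finset (Fin q)) :
    monomial x ν J ∈ A.obj.part (J.card : ZMod 2) := by
  have h1 : ((List.finRange p).map fun i =>
      A.nilPart (SuperAlg.toAlgHom x (evenCoord U q i)) ^ ν i).prod ∈ A.obj.evenPart := by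
    refine list_prod_mem fun a ha => ?_
    obtain ⟨i, -, rfl⟩ := List.mem_map.1 ha
    exact A.obj.evenPart.pow_mem (A.obj.evenPart.sub_mem
      (SuperAlg.toAlgHom_mem x (grassmannExt.inl_mem _)) (A.obj.evenPart.algebraMap_mem _)) _
  have h2 (l : List (Fin q)) : (l.map fun j => SuperAlg.toAlgHom x (oddCoord U q j)).prod ∈
      A.obj.part (l.length : ZMod 2) := by
    induction l with
    | nil =>
      rw [List.map_nil, List.prod_nil, List.length_nil, Nat.cast_zero]
      exact SetLike.GradedOne.one_mem
    | cons j l ih =>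
      rw [List.map_cons, List.prod_cons, List.length_cons, Nat.cast_add, Nat.cast_one, add_comm]
      exact SetLike.mul_mem_graded
        (SuperAlg.toAlgHom_mem x (grassmannExt.inr_mem (Grassmann.gen_mem j))) ih
  have h3 := h2 J.sort
  rw [Finset.length_sort] at h3
  have h4 := SetLike.mul_mem_graded (A := A.obj.part) (i := 0) h1 h3
  rwa [zero_add] at h4

theorem finite_support_eval (F : FormalSeries U q) (x : sections U q ⟶ A.obj) :
    (Function.support fun νJ : (Fin p →₀ ℕ) × Finset (Fin q) =>
      coeff F νJ.1 νJ.2 (basePoint x) • monomial x νJ.1 νJ.2).Finite :=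
  (finite_support_monomial x).subset fun _ h h0 => h (by simp only [h0, smul_zero])

/-- This is the naturality of evaluation: morphisms preserve the base point and send monomials to
monomials. -/
theorem toAlgHom_eval (F : FormalSeries U q) (x : sections U q ⟶ A.obj) (ρ : A.obj ⟶ B.obj) :
    SuperAlg.toAlgHom ρ (eval F x) = eval F (x ≫ ρ) := by
  rw [eval, eval]
  refine (AddMonoidHom.map_finsum (SuperAlg.toAlgHom ρ : A.obj →+ B.obj)
    (finite_support_eval F x)).trans (finsum_congr fun νJ => ?_)
  change SuperAlg.toAlgHom ρ _ = _
  rw [map_smul, toAlgHom_monomial, basePoint_comp]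

theorem eval_mem {F : FormalSeries U q} {i : ZMod 2} (hF : F ∈ (FormalSeries U q).part i)
    (x : sections U q ⟶ A.obj) : eval F x ∈ A.obj.part i := by
  rw [eval]
  refine finsum_induction (· ∈ A.obj.part i) (zero_mem _) (fun _ _ => add_mem) fun νJ => ?_
  by_cases h : (νJ.2.card : ZMod 2) = i
  · exact Submodule.smul_mem _ _ (h ▸ monomial_mem x νJ.1 νJ.2)
  · rw [coeff_eq_zero hF νJ.1 h, Pi.zero_apply, zero_smul]
    exact zero_mem _

theorem body_monomial (x : sections U q ⟶ A.obj) {ν : Fin p →₀ ℕ} {J : Finset (Fin q)}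
    (h : (ν, J) ≠ (0, ∅)) : A.body (monomial x ν J) = 0 := by
  rw [monomial, map_mul, map_list_prod, map_list_prod, List.map_map, List.map_map, mul_eq_zero]
  by_cases hJ : J = ∅
  · left
    have hν : ν ≠ 0 := fun h0 => h (by rw [h0, hJ])
    obtain ⟨i, hi⟩ := Finsupp.ne_iff.1 hν
    refine List.prod_eq_zero (List.mem_map.2 ⟨i, List.mem_finRange i, ?_⟩)
    rw [Function.comp_apply, map_pow, SWA.mem_nilIdeal_iff.1 (A.nilPart_mem _)]
    exact zero_pow hi
  · right
    obtain ⟨j, hj⟩ := Finset.nonempty_iff_ne_empty.2 hJ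
    refine List.prod_eq_zero (List.mem_map.2 ⟨j, (Finset.mem_sort _).2 hj, ?_⟩)
    exact SWA.body_odd (SuperAlg.toAlgHom_mem x (grassmannExt.inr_mem (Grassmann.gen_mem j)))

theorem monomial_zero (x : sections U q ⟶ A.obj) : monomial x 0 ∅ = 1 := by
  simp [monomial]

/-- Only the constant term survives modulo nilpotents; hence the condition that constant terms take
values in `V`. -/
theorem body_eval (F : FormalSeries U q) (x : sections U q ⟶ A.obj) :
    A.body (eval F x) = coeff F 0 ∅ (basePoint x) := by
  rw [eval]
  refine (AddMonoidHom.map_finsum (A.body : A.obj →+ ℝ) (finite_support_eval F x)).trans ?_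
  refine (finsum_eq_single _ (0, ∅) fun νJ h => ?_).trans ?_
  · change A.body _ = 0
    rw [map_smul, body_monomial x h, smul_zero]
  · change A.body _ = _
    rw [map_smul, monomial_zero, map_one, smul_eq_mul, mul_one]

/-- The truncation of a component of a formal series, with coefficients evaluated at `y`. -/
def truncation (F : FormalSeries U q) (y : U) (K : ℕ) (J : Finset (Fin q)) :
    MvPolynomial (Fin p) ℝ :=
  ∑ ν ∈ (Finsupp.finite_of_degree_lt (σ := Fin p) K).toFinset,
    MvPolynomial.monomial ν (coeff F ν J y)

theorem coeff_truncation (F : FormalSeries U q) (y : U) {K : ℕ} (J : Finset (Fin q))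
    {ν : Fin p →₀ ℕ} (hν : ν.degree < K) :
    (truncation F y K J).coeff ν = coeff F ν J y := by
  classical
  rw [truncation, MvPolynomial.coeff_sum, Finset.sum_eq_single ν]
  · rw [MvPolynomial.coeff_monomial, if_pos rfl]
  · intro μ _ h
    rw [MvPolynomial.coeff_monomial, if_neg h]
  · intro h
    exact absurd (by simpa using hν) h

theorem monomial_jetPoint (y : U) (K : ℕ) (ν : Fin p →₀ ℕ) (J : Finset (Fin q)) :
    monomial (jetPoint y K q) ν J =
      (grassmannExt.inl _ q (Jet.ofPolynomial y (K + 1) (MvPolynomial.monomial ν 1)) *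
        grassmannExt.inr _ q (Grassmann.monomialBasis q J) :
          grassmannExt (Jet y (K + 1)) q) := by
  rw [monomial]
  refine congrArg₂ (fun a b : grassmannExt (Jet y (K + 1)) q => a * b) ?_ ?_
  · simp_rw [nilPart_jetPoint]
    rw [MvPolynomial.monomial_eq, MvPolynomial.C_1, one_mul, Finsupp.prod_fintype _ _ (by simp),
      ← List.prod_ofFn, List.ofFn_eq_map, map_list_prod, map_list_prod, List.map_map, List.map_map]
    refine congrArg List.prod (List.map_congr_left fun i _ => ?_)
    simp only [Function.comp_apply, map_pow]
    rfl
  · rw [Grassmann.monomialBasis_apply, map_list_prod, List.map_map]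
    refine congrArg List.prod (List.map_congr_left fun j _ => ?_)
    exact jetPoint_inr _

/-- The generic point has nilpotent coordinates `X i` and odd coordinates the generators, so
evaluating there returns the truncated series itself. -/
theorem eval_jetPoint (F : FormalSeries U q) (y : U) (K : ℕ) :
    eval F (jetPoint y K q) =
      (∑ J, grassmannExt.inl _ q (Jet.ofPolynomial y (K + 1) (truncation F y (K + 1) J)) *
        grassmannExt.inr _ q (Grassmann.monomialBasis q J) :
          grassmannExt (Jet y (K + 1)) q) := by
  let s := (Finsupp.finite_of_degree_lt (σ := Fin p) (K + 1)).toFinset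
  have h : eval F (jetPoint y K q) = ∑ νJ ∈ s ×ˢ Finset.univ,
      coeff F νJ.1 νJ.2 y • monomial (jetPoint y K q) νJ.1 νJ.2 := by
    rw [eval, basePoint_jetPoint]
    refine finsum_eq_sum_of_support_subset _ fun νJ h => ?_
    by_contra hν
    refine h ?_
    have hν' : ¬ νJ.1.degree < K + 1 := fun h' => hν (by simpa [s] using h')
    have h0 : Jet.ofPolynomial y (K + 1) (MvPolynomial.monomial νJ.1 1) = 0 := by
      rw [Jet.ofPolynomial_eq_zero_iff,
        MvPolynomial.monomial_mem_pow_idealOfVars_iff _ _ one_ne_zero]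
      exact not_lt.1 hν'
    simp only [monomial_jetPoint, h0, map_zero, zero_mul]
    exact smul_zero (A := grassmannExt (Jet y (K + 1)) q) _
  rw [h, Finset.sum_product_right]
  refine Finset.sum_congr rfl fun J _ => ?_
  rw [truncation, map_sum, map_sum, Finset.sum_mul]
  refine Finset.sum_congr rfl fun ν _ => ?_
  rw [monomial_jetPoint, ← mul_one (coeff F ν J y), ← smul_eq_mul (coeff F ν J y) 1,
    ← MvPolynomial.smul_monomial, map_smul, map_smul, smul_mul_assoc, smul_eq_mul, mul_one]
  rfl

end FormalSeries

/-! ### Formal series as compatible families of jets. -/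

namespace FormalSeries

variable {p q : ℕ} {U : Opens (Fin p → ℝ)}

theorem ext_eval_jetPoint {F G : FormalSeries U q}
    (h : ∀ y K, eval F (jetPoint y K q) = eval G (jetPoint y K q)) : F = G := by
  refine ext_coeff fun ν J => funext fun y => ?_
  -- Jets of order `ν.degree` are just large enough to see the coefficient at `ν`.
  have h1 := h y ν.degree
  rw [eval_jetPoint, eval_jetPoint] at h1
  have h2 := congrArg (grassmannExt.comp J) h1
  rw [grassmannExt.comp_sum, grassmannExt.comp_sum, Jet.ofPolynomial_eq_iff] at h2
  have h3 := h2 ν (Nat.lt_succ_self _)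
  rwa [coeff_truncation _ _ _ (Nat.lt_succ_self _),
    coeff_truncation _ _ _ (Nat.lt_succ_self _)] at h3

/-- A compatible family of elements of the jet algebras comes from a formal series. -/
theorem exists_eval_jetPoint_eq {i : ZMod 2} (z : ∀ (y : U) (K : ℕ), (jetAlg y K q).obj)
    (hz : ∀ y K, z y K ∈ (jetAlg y K q).obj.part i)
    (hcompat : ∀ y K K' (π : (jetAlg y K' q).obj ⟶ (jetAlg y K q).obj),
      jetPoint y K' q ≫ π = jetPoint y K q → SuperAlg.toAlgHom π (z y K') = z y K) :
    ∃ F ∈ (FormalSeries U q).part i, ∀ y K, eval F (jetPoint y K q) = z y K := by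
  have hex (y : U) (K : ℕ) (J : Finset (Fin q)) : ∃ P, Jet.ofPolynomial y (K + 1) P =
      grassmannExt.comp (C := Jet y (K + 1)) J (z y K) := Jet.ofPolynomial_surjective _
  choose P hP using hex
  have hsum (y : U) (K : ℕ) : z y K =
      (∑ J, grassmannExt.inl _ q (Jet.ofPolynomial y (K + 1) (P y K J)) *
        grassmannExt.inr _ q (Grassmann.monomialBasis q J) :
          grassmannExt (Jet y (K + 1)) q) := by
    simp_rw [hP]
    exact grassmannExt.eq_sum (C := Jet y (K + 1)) (z y K)
  -- Coefficients of degree at most `K` do not change when the order of the jets grows, because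
  -- truncation carries one value to the other.
  have hcoeff (y : U) (J : Finset (Fin q)) {K K' : ℕ} (h : K ≤ K') (ν : Fin p →₀ ℕ)
      (hν : ν.degree < K + 1) : (P y K' J).coeff ν = (P y K J).coeff ν := by
    obtain ⟨π, hπ, hl, hr⟩ := exists_truncation y q h
    have h1 := hcompat y K K' π hπ
    rw [hsum y K, hsum y K'] at h1
    have h2 : (∑ J, grassmannExt.inl _ q (Jet.ofPolynomial y (K + 1) (P y K' J)) *
        grassmannExt.inr _ q (Grassmann.monomialBasis q J) : grassmannExt (Jet y (K + 1)) q) =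
        ∑ J, grassmannExt.inl _ q (Jet.ofPolynomial y (K + 1) (P y K J)) *
        grassmannExt.inr _ q (Grassmann.monomialBasis q J) := by
      refine Eq.trans ?_ h1
      refine Eq.trans (Finset.sum_congr rfl fun J _ => ?_)
        (map_sum (SuperAlg.toAlgHom π) _ _).symm
      exact ((map_mul (SuperAlg.toAlgHom π) _ _).trans (congrArg₂ _ (hl _) (hr _))).symm
    have h3 := congrArg (grassmannExt.comp J) h2
    rw [grassmannExt.comp_sum, grassmannExt.comp_sum, Jet.ofPolynomial_eq_iff] at h3
    exact h3 ν hν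
  have hparity (y : U) (K : ℕ) (J : Finset (Fin q)) (hJ : (J.card : ZMod 2) ≠ i)
      (ν : Fin p →₀ ℕ) (hν : ν.degree < K + 1) : (P y K J).coeff ν = 0 := by
    have h1 := hP y K J
    rw [grassmannExt.comp_eq_zero (C := Jet y (K + 1)) (hz y K) hJ,
      ← map_zero (Jet.ofPolynomial y (K + 1)), Jet.ofPolynomial_eq_iff] at h1
    rw [h1 ν hν, MvPolynomial.coeff_zero]
  refine ⟨ofCoeff fun ν J y => (P y ν.degree J).coeff ν, ofCoeff_mem fun ν J hJ =>
    funext fun y => hparity y _ J hJ ν (Nat.lt_succ_self _), fun y K => ?_⟩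
  rw [eval_jetPoint, hsum]
  refine Finset.sum_congr rfl fun J _ => ?_
  congr 2
  rw [Jet.ofPolynomial_eq_iff]
  intro ν hν
  rw [coeff_truncation _ _ _ hν, coeff_ofCoeff]
  exact (hcoeff y J (Nat.le_of_lt_succ hν) ν (Nat.lt_succ_self _)).symm

end FormalSeries

/-! ### Natural transformations -/

namespace SeriesTuple

variable {p q m n : ℕ} {U : Opens (Fin p → ℝ)} {V : Opens (Fin m → ℝ)} {A B : SWA}

theorem exists_pointMap (F : SeriesTuple U q V n) (x : sections U q ⟶ A.obj) :
    ∃ x' : sections V n ⟶ A.obj,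
      (∀ k, SuperAlg.toAlgHom x' (evenCoord V n k) = FormalSeries.eval (F.even k) x) ∧
      ∀ l, SuperAlg.toAlgHom x' (oddCoord V n l) = FormalSeries.eval (F.odd l) x := by
  refine exists_sections_hom _ _ (fun k => FormalSeries.eval_mem (F.even_mem k) x)
    (fun l => FormalSeries.eval_mem (F.odd_mem l) x) ?_
  simp_rw [FormalSeries.body_eval]
  exact F.const_mem _

/-- The map on points defined by a tuple of formal series. -/
def pointMap (F : SeriesTuple U q V n) (x : sections U q ⟶ A.obj) : sections V n ⟶ A.obj :=
  (F.exists_pointMap x).choose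

theorem pointMap_evenCoord (F : SeriesTuple U q V n) (x : sections U q ⟶ A.obj) (k : Fin m) :
    SuperAlg.toAlgHom (F.pointMap x) (evenCoord V n k) = FormalSeries.eval (F.even k) x :=
  (F.exists_pointMap x).choose_spec.1 k

theorem pointMap_oddCoord (F : SeriesTuple U q V n) (x : sections U q ⟶ A.obj) (l : Fin n) :
    SuperAlg.toAlgHom (F.pointMap x) (oddCoord V n l) = FormalSeries.eval (F.odd l) x :=
  (F.exists_pointMap x).choose_spec.2 l

theorem pointMap_comp (F : SeriesTuple U q V n) (x : sections U q ⟶ A.obj)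
    (ρ : A.obj ⟶ B.obj) : F.pointMap (x ≫ ρ) = F.pointMap x ≫ ρ := by
  refine sections_hom_ext (fun k => ?_) fun l => ?_
  · rw [pointMap_evenCoord, SuperAlg.toAlgHom_comp, AlgHom.comp_apply, pointMap_evenCoord,
      FormalSeries.toAlgHom_eval]
  · rw [pointMap_oddCoord, SuperAlg.toAlgHom_comp, AlgHom.comp_apply, pointMap_oddCoord,
      FormalSeries.toAlgHom_eval]

/-- The natural transformation defined by a tuple of formal series. -/
def toNatTrans (F : SeriesTuple U q V n) : points U q ⟶ points V n where
  app A := TypeCat.ofHom fun x : sections U q ⟶ A.obj => F.pointMap x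
  naturality A B ρ := by
    ext x
    exact F.pointMap_comp x ρ.hom

theorem toNatTrans_injective :
    Function.Injective (toNatTrans : SeriesTuple U q V n → (points U q ⟶ points V n)) := by
  intro F G h
  have hpt {A : SWA} (x : sections U q ⟶ A.obj) : F.pointMap x = G.pointMap x :=
    congrArg (fun α : points U q ⟶ points V n => (α.app A x : sections V n ⟶ A.obj)) h
  have he : F.even = G.even := funext fun k => FormalSeries.ext_eval_jetPoint fun y K => by
    rw [← pointMap_evenCoord, hpt, pointMap_evenCoord]
  have ho : F.odd = G.odd := funext fun l => FormalSeries.ext_eval_jetPoint fun y K => by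
    rw [← pointMap_oddCoord, hpt, pointMap_oddCoord]
  cases F
  cases G
  congr

theorem app_comp (α : points U q ⟶ points V n) (x : sections U q ⟶ A.obj) (ρ : A.obj ⟶ B.obj) :
    (α.app B (x ≫ ρ) : sections V n ⟶ B.obj) = (α.app A x : sections V n ⟶ A.obj) ≫ ρ :=
  congrArg (fun φ : (points U q).obj A ⟶ (points V n).obj B => (φ x : sections V n ⟶ B.obj))
    (α.naturality (ObjectProperty.homMk ρ))

/-- The values of `α` at jet points are compatible by naturality, so they come from series. Any
other point is the image of a jet point, where naturality again forces agreement. -/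
theorem toNatTrans_surjective :
    Function.Surjective (toNatTrans : SeriesTuple U q V n → (points U q ⟶ points V n)) := by
  intro α
  let w (y : U) (K : ℕ) : sections V n ⟶ (jetAlg y K q).obj := α.app (jetAlg y K q) (jetPoint y K q)
  have hw (y : U) (K K' : ℕ) (π : (jetAlg y K' q).obj ⟶ (jetAlg y K q).obj)
      (hπ : jetPoint y K' q ≫ π = jetPoint y K q) (s : sections V n) :
      SuperAlg.toAlgHom π (SuperAlg.toAlgHom (w y K') s) = SuperAlg.toAlgHom (w y K) s := by
    have h : w y K = w y K' ≫ π := by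
      rw [← app_comp, hπ]
    rw [h]
    rfl
  choose E hE hE' using fun k => FormalSeries.exists_eval_jetPoint_eq
    (fun y K => SuperAlg.toAlgHom (w y K) (evenCoord V n k))
    (fun y K => SuperAlg.toAlgHom_mem _ (grassmannExt.inl_mem _))
    (fun y K K' π hπ => hw y K K' π hπ _)
  choose O hO hO' using fun l => FormalSeries.exists_eval_jetPoint_eq
    (fun y K => SuperAlg.toAlgHom (w y K) (oddCoord V n l))
    (fun y K => SuperAlg.toAlgHom_mem _ (grassmannExt.inr_mem (Grassmann.gen_mem l)))
    (fun y K K' π hπ => hw y K K' π hπ _)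
  -- The constant terms at `y` are the coordinates of the base point of `w y 0`, which lies in `V`.
  let F : SeriesTuple U q V n := ⟨E, O, hE, hO, fun y => by
    have h : (fun k => FormalSeries.coeff (E k) 0 ∅ y) = (basePoint (w y 0)).1 := by
      funext k
      have h1 := FormalSeries.body_eval (E k) (jetPoint y 0 q)
      rw [basePoint_jetPoint, hE'] at h1
      exact h1.symm
    rw [h]
    exact (basePoint (w y 0)).2⟩
  have hF (y : U) (K : ℕ) : F.pointMap (jetPoint y K q) = w y K :=
    sections_hom_ext (fun k => (F.pointMap_evenCoord _ k).trans (hE' k y K))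
      fun l => (F.pointMap_oddCoord _ l).trans (hO' l y K)
  refine ⟨F, NatTrans.ext (funext fun A => ?_)⟩
  ext x
  obtain ⟨K, ρ, hρ⟩ := exists_jetPoint_comp x
  change F.pointMap x = (α.app A x : sections V n ⟶ A.obj)
  rw [← hρ, pointMap_comp, app_comp, hF]

end SeriesTuple

end

theorem mainTheorem5 (p q m n : ℕ) (U : Opens (Fin p → ℝ)) (V : Opens (Fin m → ℝ)) :
    ∃ Φ : SeriesTuple U q V n ≃ (points U q ⟶ points V n),
      ∀ (F : SeriesTuple U q V n) (A : SWA) (x : sections U q ⟶ A.obj),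
        (∀ k : Fin m, SuperAlg.toAlgHom ((Φ F).app A x : sections V n ⟶ A.obj) (evenCoord V n k) =
          FormalSeries.eval (F.even k) x) ∧
        (∀ l : Fin n, SuperAlg.toAlgHom ((Φ F).app A x : sections V n ⟶ A.obj) (oddCoord V n l) =
          FormalSeries.eval (F.odd l) x) :=
  ⟨Equiv.ofBijective SeriesTuple.toNatTrans
    ⟨SeriesTuple.toNatTrans_injective, SeriesTuple.toNatTrans_surjective⟩,
    fun F _ x => ⟨F.pointMap_evenCoord x, F.pointMap_oddCoord x⟩⟩
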